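/- Let $\Lambda=(\lambda_k)_{k\ge 0}$ be a strictly increasing sequence of positive real numbers. Assume that $\Lambda$ is quasi-lacunary and subgeometric: there are $N\ge 1$, $q>1$, $q'>1$ and integers $-1=n_0<n_1<n_2<\cdots$ such that the consecutive blocks $E_k=\{\lambda_{n_k+1},\dots,\lambda_{n_{k+1}}\}$, $k\ge 0$, which partition $\Lambda$, have at most $N$ elements, and $$q<\frac{\lambda_{n_{k+1}}}{\lambda_{n_k}}\le q'\qquad\text{for all sufficiently large }k.$$ Let $\alpha>0$ and $\beta\ge 1$, and let $\mu$ be a finite positive Borel measure on $[0,1]$. Let $M_\Lambda$ be the space of all finite sums $f(t)=\sum_{k=0}^K a_k t^{\lambda_k}$, $a_k\in\mathbb C$, and for $1\le s<\infty$ let $M^s_{\Lambda,\alpha}$ be the closure of $M_\Lambda$ in $L^s\big([0,1],(1-x)^{\alpha-1}\,dx\big)$. Then the following are equivalent: (i) There is a constant $C$ such that $\mu([1-\varepsilon,1])\le C\,\varepsilon^{\alpha\beta}$ for all $\varepsilon\in(0,1]$. (ii) For every real $p\ge\beta$ one has the embedding $M^{p/\beta}_{\Lambda,\alpha}\hookrightarrow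 L^p(\mu)$, that is, the inclusion $f\mapsto f$ of $M_\Lambda$ into $L^p(\mu)$ extends to a bounded linear operator $M^{p/\beta}_{\Lambda,\alpha}\to L^p(\mu)$; equivalently, there is a constant $C_p$ such that $\|f\|_{L^p(\mu)}\le C_p\,\|f\|_{L^{p/\beta}((1-x)^{\alpha-1}dx)}$ for all $f\in M_\Lambda$. -/

import Mathlib

open MeasureTheory Filter
open scoped ENNReal NNReal

/-- `n` lists the last indices of consecutive nonempty blocks of length at most `N` that partition
the index set `ℕ`: block `0` is `{0, …, n 0}` and block `k + 1` is `{n k + 1, …, n (k + 1)}`. -/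
def IsBlockPartition (N : ℕ) (n : ℕ → ℕ) : Prop :=
  StrictMono n ∧ n 0 + 1 ≤ N ∧ ∀ k, n (k + 1) ≤ n k + N

/-- The sequence `Λ` is quasi-lacunary and subgeometric: it splits into consecutive blocks of
bounded length such that the ratio of the last elements of consecutive blocks eventually lies
in `(q, q']`, for some `q > 1` and `q' > 1`. -/
def IsQuasiLacunarySubgeometric (Λ : ℕ → ℝ) : Prop :=
  ∃ (N : ℕ) (n : ℕ → ℕ), IsBlockPartition N n ∧
    (∃ q : ℝ, 1 < q ∧ ∀ᶠ k in atTop, q < Λ (n (k + 1)) / Λ (n k)) ∧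
    (∃ q' : ℝ, 1 < q' ∧ ∀ᶠ k in atTop, Λ (n (k + 1)) / Λ (n k) ≤ q')

/-- The space `M_Λ` of Müntz polynomials `t ↦ ∑ a_k t ^ λ_k` (finite sums, complex coefficients).
Only the values on `[0,1]` matter, as all measures below are carried by `[0,1]`. -/
noncomputable def muntzPolynomials (Λ : ℕ → ℝ) : Submodule ℂ (ℝ → ℂ) :=
  Submodule.span ℂ (Set.range fun k : ℕ => fun t : ℝ => ((t ^ Λ k : ℝ) : ℂ))

/-- The measure `(1 - x) ^ (α - 1) dx` on `[0,1]`. -/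
noncomputable def weightMeasure (α : ℝ) : Measure ℝ :=
  (volume.restrict (Set.Icc (0 : ℝ) 1)).withDensity
    fun x => ENNReal.ofReal ((1 - x) ^ (α - 1))

/-- The classes in `L^s((1 - x) ^ (α - 1) dx)` of the Müntz polynomials. -/
noncomputable def muntzClasses (Λ : ℕ → ℝ) (α : ℝ) (s : ℝ≥0∞) [Fact (1 ≤ s)] :
    Submodule ℂ (Lp ℂ s (weightMeasure α)) where
  carrier := {F | ∃ f ∈ muntzPolynomials Λ, F =ᵐ[weightMeasure α] f}
  add_mem' := by
    rintro F G ⟨f, hf, hF⟩ ⟨g, hg, hG⟩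
    exact ⟨f + g, add_mem hf hg, (Lp.coeFn_add F G).trans (hF.add hG)⟩
  zero_mem' := ⟨0, zero_mem _, Lp.coeFn_zero _ _ _⟩
  smul_mem' := by
    rintro c F ⟨f, hf, hF⟩
    exact ⟨c • f, Submodule.smul_mem _ c hf, (Lp.coeFn_smul c F).trans (hF.const_smul c)⟩

/-- The Müntz space `M^s_{Λ,α}`: the closure of `M_Λ` in `L^s((1 - x) ^ (α - 1) dx)`. -/
noncomputable def muntzSpace (Λ : ℕ → ℝ) (α : ℝ) (s : ℝ≥0∞) [Fact (1 ≤ s)] :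
    Submodule ℂ (Lp ℂ s (weightMeasure α)) :=
  (muntzClasses Λ α s).topologicalClosure

/-- The embedding `M^s_{Λ,α} ↪ L^r(μ)`, for real exponents `s, r ≥ 1`: there is a bounded linear
operator `M^s_{Λ,α} → L^r(μ)` that maps every Müntz polynomial to itself. (It is unique by density,
and exists iff `‖f‖_{L^r(μ)} ≤ C ‖f‖_{L^s((1 - x) ^ (α - 1) dx)}` on `M_Λ`; as usual in this
setting, an embedding is a continuous inclusion and need not be injective on `μ`-classes.) -/
def MuntzEmbedding (Λ : ℕ → ℝ) (α s r : ℝ) (μ : Measure ℝ) (hs : 1 ≤ s) (hr : 1 ≤ r) : Prop :=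
  haveI : Fact (1 ≤ ENNReal.ofReal s) := ⟨ENNReal.one_le_ofReal.2 hs⟩
  haveI : Fact (1 ≤ ENNReal.ofReal r) := ⟨ENNReal.one_le_ofReal.2 hr⟩
  ∃ J : muntzSpace Λ α (ENNReal.ofReal s) →L[ℂ] Lp ℂ (ENNReal.ofReal r) μ,
    ∀ f ∈ muntzPolynomials Λ, ∃ F : muntzSpace Λ α (ENNReal.ofReal s),
      (F : Lp ℂ (ENNReal.ofReal s) (weightMeasure α)) =ᵐ[weightMeasure α] f ∧ J F =ᵐ[μ] f

/-- The class `𝓜_{x^γ}`: `μ([1 - ε, 1]) ≤ C ε ^ γ` for all `ε ∈ (0,1]`, with `C` independent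
of `ε`. -/
def InClassM (γ : ℝ) (μ : Measure ℝ) : Prop :=
  ∃ C : ℝ≥0, ∀ ε : ℝ, 0 < ε → ε ≤ 1 →
    μ (Set.Icc (1 - ε) 1) ≤ (C : ℝ≥0∞) * ENNReal.ofReal (ε ^ γ)

/-! (i) ⇒ (ii). Put s = p/β, V = 1 - T, v = 1 - u. The core is the pointwise bound |f(T)|^s V^(2α) ≤
D ∫ |f(u)|^s v^(α-1) k(V, v) du with k = min(V^(3α/2) v^(-α/2), v^α)
(`exists_enorm_muntzSum_rpow_le`). Hölder with exponent β against |f(u)|^s v^(α-1) du, followed by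
Tonelli, reduces the embedding to a bound, uniform in v, for the μ-integral of V^(-2αβ) k^β.
Condition (i) gives this bound by a dyadic decomposition of the distance to 1
(`InClassM.exists_lintegral_kernel_le`).

For the pointwise bound, set X = -log T and split the frequencies at lam X ≈ A. The operator f ↦ f +
∑ c_i t^(-σ_i) ∫_0^t u^(σ_i-1) f(u) du multiplies t^x by ∏ (x - lam_i)/(x + σ_i), hence kills the
low frequencies. Its poles lie on a genuinely lacunary majorant σ of Λ, because exponents within a
block may be arbitrarily close; so the residues are O(σ_i), and the correction is at most a multiple
of ∫ |f|/(1-u) (`exists_highPart`). The remaining high-frequency sum is small at T compared with its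
supremum on [T, √T], since one difference operator per frequency annihilates it (`norm_sum_exp_le`).
Together, |f(T)| ≤ η sup_[T,√T] |f| + D ∫_0^√T |f|/(1-u). The first term is absorbed by taking the
supremum of |f|^s (1-t)^(2α) over [T, 1), and Hölder treats the second.

(ii) ⇒ (i). Testing p = β on t^lam_k bounds μ near 1 at the scales 1/lam_k. Subgeometric growth
leaves only bounded gaps between these scales. -/

/-! ### Quasi-lacunary sequences and their lacunary majorants -/

theorem exists_forall_lt_mul_le_of_strictMono {lam : ℕ → ℝ} (hpos : ∀ k, 0 < lam k)
    (hmono : StrictMono lam) {L : ℕ} (hL : 0 < L) (m : ℕ) :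
    ∃ q : ℝ, 1 < q ∧ ∀ i < m, q * lam i ≤ lam (i + L) := by
  induction m with
  | zero => exact ⟨2, by norm_num, by simp⟩
  | succ m ih =>
    obtain ⟨q, hq, h⟩ := ih
    have h1 : lam m < lam (m + L) := hmono (by omega)
    refine ⟨min q (lam (m + L) / lam m), lt_min hq ((one_lt_div (hpos m)).2 h1), ?_⟩
    intro i hi
    rcases Nat.lt_succ_iff_lt_or_eq.1 hi with hi | rfl
    · exact (mul_le_mul_of_nonneg_right (min_le_left _ _) (hpos i).le).trans (h i hi)
    · calc _ ≤ lam (i + L) / lam i * lam i :=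
            mul_le_mul_of_nonneg_right (min_le_right _ _) (hpos i).le
        _ = _ := div_mul_cancel₀ _ (hpos i).ne'

/-- In a quasi-lacunary sequence, a fixed number of steps gains a fixed factor. -/
theorem IsQuasiLacunarySubgeometric.exists_mul_le {lam : ℕ → ℝ} (hpos : ∀ k, 0 < lam k)
    (hmono : StrictMono lam) (h : IsQuasiLacunarySubgeometric lam) :
    ∃ (L : ℕ) (q : ℝ), 0 < L ∧ 1 < q ∧ ∀ i, q * lam i ≤ lam (i + L) := by
  obtain ⟨N, n, ⟨hn, hn0, hnN⟩, ⟨q, hq, hqe⟩, -⟩ := h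
  obtain ⟨k₀, hk₀⟩ := eventually_atTop.1 hqe
  have hL : 0 < 2 * N := by omega
  obtain ⟨q₁, hq₁, h₁⟩ := exists_forall_lt_mul_le_of_strictMono hpos hmono hL (n k₀ + 1)
  -- From an index i past the initial range, at most 2N steps reach the end of the block after the
  -- one containing i, and the block ends gain the factor q.
  refine ⟨2 * N, min q q₁, hL, lt_min hq hq₁, fun i => ?_⟩
  rcases lt_or_ge i (n k₀ + 1) with hi | hi
  · exact (mul_le_mul_of_nonneg_right (min_le_right _ _) (hpos i).le).trans (h₁ i hi)
  · have hex : ∃ k, i ≤ n k := ⟨i, hn.le_apply⟩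
    classical
    obtain ⟨k, hk, hkmin⟩ : ∃ k, i ≤ n k ∧ ∀ l < k, ¬ i ≤ n l :=
      ⟨Nat.find hex, Nat.find_spec hex, fun l hl => Nat.find_min hex hl⟩
    have hkk : k₀ < k := by
      by_contra hcon
      have := hn.monotone (not_lt.1 hcon)
      omega
    obtain ⟨k', rfl⟩ : ∃ k', k = k' + 1 := ⟨k - 1, by omega⟩
    have h2 := hkmin k' (by omega)
    have h3 := hk₀ (k' + 1) (by omega)
    rw [lt_div_iff₀ (hpos _)] at h3
    have h4 := hnN k'
    have h5 := hnN (k' + 1)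
    calc min q q₁ * lam i ≤ q * lam i :=
          mul_le_mul_of_nonneg_right (min_le_left _ _) (hpos i).le
      _ ≤ q * lam (n (k' + 1)) :=
          mul_le_mul_of_nonneg_left (hmono.monotone hk) (by linarith)
      _ ≤ lam (n (k' + 1 + 1)) := h3.le
      _ ≤ lam (i + 2 * N) := hmono.monotone (by omega)

/-- `σ` is a lacunary sequence with ratio at least `θ` that dominates `lam`, is comparable to it
and starts above `2`. -/
structure IsLacunaryMajorant (lam σ : ℕ → ℝ) (θ C : ℝ) : Prop where
  one_lt : 1 < θ
  pos : ∀ i, 0 < lam i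
  mono : StrictMono lam
  le : ∀ i, lam i ≤ σ i
  le_mul : ∀ i, σ i ≤ C * lam i
  mul_le_succ : ∀ i, θ * σ i ≤ σ (i + 1)
  two_le_zero : 2 ≤ σ 0

/-- If L steps gain the factor q, one step gains θ = q^(1/L) on average. Raising each term to at
least θ times its predecessor then costs only a bounded factor. -/
theorem IsQuasiLacunarySubgeometric.exists_majorant {lam : ℕ → ℝ} (hpos : ∀ k, 0 < lam k)
    (hmono : StrictMono lam) (h : IsQuasiLacunarySubgeometric lam) :
    ∃ (σ : ℕ → ℝ) (θ C : ℝ), IsLacunaryMajorant lam σ θ C := by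
  obtain ⟨L, q, hL, hq, hg⟩ := h.exists_mul_le hpos hmono
  have hL' : (L : ℝ) ≠ 0 := by exact_mod_cast hL.ne'
  set θ : ℝ := q ^ (1 / (L : ℝ)) with hθ
  have hθ1 : 1 < θ := Real.one_lt_rpow hq (by positivity)
  have hθL : θ ^ L = q := by
    rw [hθ, ← Real.rpow_natCast, ← Real.rpow_mul (by linarith), one_div_mul_cancel hL',
      Real.rpow_one]
  have hpow : ∀ (a i : ℕ), q ^ a * lam i ≤ lam (i + L * a) := by
    intro a
    induction a with
    | zero => intro i; simp
    | succ a ih =>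
      intro i
      calc q ^ (a + 1) * lam i = q * (q ^ a * lam i) := by ring
        _ ≤ q * lam (i + L * a) := mul_le_mul_of_nonneg_left (ih i) (by linarith)
        _ ≤ lam (i + L * a + L) := hg _
        _ = _ := by congr 1; ring
  -- The extra factor q pays for rounding d to a multiple of L.
  have hgrow : ∀ i d, θ ^ d * lam i ≤ q * lam (i + d) := by
    intro i d
    have h1 : θ ^ d ≤ q * q ^ (d / L) := by
      calc θ ^ d ≤ θ ^ (L * (d / L + 1)) := by
            refine pow_le_pow_right₀ hθ1.le ?_
            have := Nat.div_add_mod d L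
            have := Nat.mod_lt d hL
            rw [mul_add]; omega
        _ = q * q ^ (d / L) := by rw [pow_mul, hθL, pow_succ, mul_comm]
    calc θ ^ d * lam i ≤ q * q ^ (d / L) * lam i := mul_le_mul_of_nonneg_right h1 (hpos i).le
      _ = q * (q ^ (d / L) * lam i) := by ring
      _ ≤ q * lam (i + L * (d / L)) := mul_le_mul_of_nonneg_left (hpow _ _) (by linarith)
      _ ≤ q * lam (i + d) := mul_le_mul_of_nonneg_left
          (hmono.monotone (by have := Nat.mul_div_le d L; omega)) (by linarith)
  let σ : ℕ → ℝ := fun n => Nat.rec (max (lam 0) 2) (fun i s => max (lam (i + 1)) (θ * s)) n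
  have hσ0 : σ 0 = max (lam 0) 2 := rfl
  have hσs : ∀ i, σ (i + 1) = max (lam (i + 1)) (θ * σ i) := fun i => rfl
  set D : ℝ := max 1 (2 / lam 0) with hD
  have hD1 : 1 ≤ D := le_max_left _ _
  -- Unwinding the maxima, j is the last index at which `lam` itself was chosen, or 0; D absorbs the
  -- starting value 2.
  have hkey : ∀ i, ∃ j d, j + d = i ∧ σ i ≤ D * (θ ^ d * lam j) := by
    intro i
    induction i with
    | zero =>
      refine ⟨0, 0, rfl, ?_⟩
      rw [hσ0, pow_zero, one_mul]
      refine max_le ?_ ?_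
      · nlinarith [hpos 0]
      · calc (2 : ℝ) = 2 / lam 0 * lam 0 := (div_mul_cancel₀ _ (hpos 0).ne').symm
          _ ≤ _ := mul_le_mul_of_nonneg_right (le_max_right _ _) (hpos 0).le
    | succ i ih =>
      obtain ⟨j, d, hjd, hle⟩ := ih
      rw [hσs]
      rcases le_total (θ * σ i) (lam (i + 1)) with hc | hc
      · refine ⟨i + 1, 0, rfl, ?_⟩
        rw [max_eq_left hc]
        nlinarith [hpos (i + 1)]
      · refine ⟨j, d + 1, by omega, ?_⟩
        rw [max_eq_right hc]
        calc θ * σ i ≤ θ * (D * (θ ^ d * lam j)) :=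
              mul_le_mul_of_nonneg_left hle (by linarith)
          _ = _ := by ring
  refine ⟨σ, θ, D * q, hθ1, hpos, hmono, ?_, ?_, ?_, ?_⟩
  · intro i
    cases i with
    | zero => exact le_max_left _ _
    | succ i => exact le_max_left _ _
  · intro i
    obtain ⟨j, d, rfl, hle⟩ := hkey i
    refine hle.trans ?_
    rw [mul_assoc]
    exact mul_le_mul_of_nonneg_left (hgrow j d) (by linarith)
  · intro i
    exact le_max_right _ _
  · exact le_max_right _ _

/-! ### Sums and products over lacunary sequences -/

namespace IsLacunaryMajorant

variable {lam σ : ℕ → ℝ} {θ C : ℝ} (h : IsLacunaryMajorant lam σ θ C)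
include h

theorem two_le (i : ℕ) : 2 ≤ σ i := by
  induction i with
  | zero => exact h.two_le_zero
  | succ i ih => nlinarith [h.mul_le_succ i, h.one_lt]

theorem pow_mul_le (i d : ℕ) : θ ^ d * σ i ≤ σ (i + d) := by
  induction d with
  | zero => simp
  | succ d ih =>
    calc θ ^ (d + 1) * σ i = θ * (θ ^ d * σ i) := by ring
      _ ≤ θ * σ (i + d) := mul_le_mul_of_nonneg_left ih (by linarith [h.one_lt])
      _ ≤ _ := h.mul_le_succ _

theorem strictMono : StrictMono σ :=
  strictMono_nat_of_lt_succ fun i => by nlinarith [h.mul_le_succ i, h.one_lt, h.two_le i]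

theorem const_pos : 0 < C := by
  have h1 := h.le_mul 0
  have h2 := h.two_le_zero
  have h3 := h.pos 0
  by_contra hc
  nlinarith

/-- The Laplace kernels `σ e^{-σ z}` of a lacunary sequence sum up to at most a multiple
of `1 / z`. -/
theorem sum_mul_exp_le {z : ℝ} (hz : 0 < z) (m : ℕ) :
    ∑ i ∈ Finset.range m, σ i * Real.exp (-(σ i * z)) ≤ θ / (θ - 1) / z := by
  have hθ := h.one_lt
  -- Each term is dominated by a difference of consecutive exponentials, so the sum telescopes; the
  -- telescoping starts from the frequency 0.
  have key : ∀ a b : ℝ, 0 ≤ a → θ * a ≤ b → (1 - 1 / θ) * (b * z * Real.exp (-(b * z))) ≤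
      Real.exp (-(a * z)) - Real.exp (-(b * z)) := by
    intro a b ha hab
    have h1 : (1 - 1 / θ) * (b * z) ≤ (b - a) * z := by
      have : a ≤ b / θ := by rw [le_div_iff₀ (by linarith)]; linarith
      have e : (1 - 1 / θ) * (b * z) = (b - b / θ) * z := by ring
      rw [e]
      exact mul_le_mul_of_nonneg_right (by linarith) hz.le
    have h2 : (b - a) * z + 1 ≤ Real.exp ((b - a) * z) := Real.add_one_le_exp _
    have h3 : Real.exp (-(a * z)) = Real.exp ((b - a) * z) * Real.exp (-(b * z)) := by
      rw [← Real.exp_add]; congr 1; ring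
    rw [h3]
    nlinarith [Real.exp_pos (-(b * z))]
  have hsum : ∀ m, ∑ i ∈ Finset.range (m + 1),
      (1 - 1 / θ) * (σ i * z * Real.exp (-(σ i * z))) ≤ 1 - Real.exp (-(σ m * z)) := by
    intro m
    induction m with
    | zero =>
      have := key 0 (σ 0) le_rfl (by linarith [h.two_le 0])
      simpa using this
    | succ m ih =>
      rw [Finset.sum_range_succ]
      have := key (σ m) (σ (m + 1)) (by linarith [h.two_le m]) (h.mul_le_succ m)
      linarith
  have h1 : (1 - 1 / θ) * z * ∑ i ∈ Finset.range m, σ i * Real.exp (-(σ i * z)) ≤ 1 := by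
    cases m with
    | zero => simp
    | succ m =>
      have := hsum m
      have hp := Real.exp_pos (-(σ m * z))
      calc _ = ∑ i ∈ Finset.range (m + 1), (1 - 1 / θ) * (σ i * z * Real.exp (-(σ i * z))) := by
            rw [Finset.mul_sum]; exact Finset.sum_congr rfl fun i _ => by ring
        _ ≤ 1 := by linarith
  have h2 : 0 < 1 - 1 / θ := by
    rw [sub_pos, div_lt_one (by linarith)]; exact hθ
  have h3 : θ / (θ - 1) / z = 1 / ((1 - 1 / θ) * z) := by
    have : θ - 1 ≠ 0 := by linarith
    have : θ ≠ 0 := by linarith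
    field_simp
  rw [h3, le_div_iff₀ (by positivity)]
  linarith

theorem sum_mul_rpow_le {u : ℝ} (hu0 : 0 < u) (hu1 : u < 1) (m : ℕ) :
    ∑ i ∈ Finset.range m, σ i * u ^ (σ i - 1) ≤ 2 * (θ / (θ - 1)) / (1 - u) := by
  have hθ := h.one_lt
  have hlog : 1 - u ≤ -Real.log u := by
    have := Real.log_le_sub_one_of_pos hu0
    linarith
  -- The half comes from σ_i - 1 ≥ σ_i / 2, which is where σ_i ≥ 2 is needed.
  have hz : 0 < -Real.log u / 2 := by linarith
  calc ∑ i ∈ Finset.range m, σ i * u ^ (σ i - 1)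
      ≤ ∑ i ∈ Finset.range m, σ i * Real.exp (-(σ i * (-Real.log u / 2))) := by
        refine Finset.sum_le_sum fun i _ => ?_
        refine mul_le_mul_of_nonneg_left ?_ (by linarith [h.two_le i])
        rw [Real.rpow_def_of_pos hu0]
        refine Real.exp_le_exp.2 ?_
        nlinarith [h.two_le i]
    _ ≤ θ / (θ - 1) / (-Real.log u / 2) := h.sum_mul_exp_le hz m
    _ ≤ θ / (θ - 1) / ((1 - u) / 2) := by
        refine div_le_div_of_nonneg_left (div_nonneg (by linarith) (by linarith))
          (by linarith) (by linarith)
    _ = _ := by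
        have : 1 - u ≠ 0 := by linarith
        field_simp

/-- Far out, the sum of the inverse square roots of a quasi-lacunary sequence is small. -/
theorem exists_sum_inv_sqrt_le {δ : ℝ} (hδ : 0 < δ) :
    ∃ A : ℝ, 0 < A ∧ ∀ X : ℝ, 0 < X → ∀ m K : ℕ, A ≤ lam m * X →
      ∑ j ∈ Finset.Ico m K, 1 / Real.sqrt (lam j * X) ≤ δ := by
  have hθ := h.one_lt
  have hC := h.const_pos
  set r : ℝ := 1 / Real.sqrt θ with hr
  have hsθ : 1 < Real.sqrt θ := by rw [Real.lt_sqrt (by norm_num)]; simpa using hθ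
  have hr0 : 0 < r := by positivity
  have hr1 : r < 1 := by rw [hr, div_lt_one (by positivity)]; exact hsθ
  have h1r : 0 < 1 - r := by linarith
  -- A makes the terms at most δ(1-r) r^d, a geometric series of sum δ; the factor C pays for
  -- passing between `lam` and σ.
  refine ⟨C / (δ * (1 - r)) ^ 2, by positivity, fun X hX m K hA => ?_⟩
  have hterm : ∀ d, 1 / Real.sqrt (lam (m + d) * X) ≤ δ * (1 - r) * r ^ d := by
    intro d
    have h1 : θ ^ d / (δ * (1 - r)) ^ 2 ≤ lam (m + d) * X := by
      have e1 : θ ^ d * lam m ≤ C * lam (m + d) :=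
        (mul_le_mul_of_nonneg_left (h.le m) (by positivity)).trans
          ((h.pow_mul_le m d).trans (h.le_mul _))
      have e2 : C * (θ ^ d / (δ * (1 - r)) ^ 2) ≤ C * (lam (m + d) * X) := by
        calc C * (θ ^ d / (δ * (1 - r)) ^ 2) = θ ^ d * (C / (δ * (1 - r)) ^ 2) := by ring
          _ ≤ θ ^ d * (lam m * X) := mul_le_mul_of_nonneg_left hA (by positivity)
          _ = θ ^ d * lam m * X := by ring
          _ ≤ C * lam (m + d) * X := mul_le_mul_of_nonneg_right e1 hX.le
          _ = _ := by ring
      exact le_of_mul_le_mul_left e2 hC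
    have h2 : Real.sqrt θ ^ d / (δ * (1 - r)) ≤ Real.sqrt (lam (m + d) * X) := by
      refine Real.le_sqrt_of_sq_le ?_
      refine le_trans (le_of_eq ?_) h1
      rw [div_pow, ← pow_mul, mul_comm d 2, pow_mul, Real.sq_sqrt (by linarith)]
    calc 1 / Real.sqrt (lam (m + d) * X) ≤ 1 / (Real.sqrt θ ^ d / (δ * (1 - r))) :=
          one_div_le_one_div_of_le (by positivity) h2
      _ = δ * (1 - r) * r ^ d := by rw [hr, one_div_div, div_pow, one_pow]; ring
  rw [Finset.sum_Ico_eq_sum_range]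
  calc _ ≤ ∑ d ∈ Finset.range (K - m), δ * (1 - r) * r ^ d :=
        Finset.sum_le_sum fun d _ => hterm d
    _ = δ * (1 - r) * ∑ d ∈ Finset.range (K - m), r ^ d := by rw [Finset.mul_sum]
    _ ≤ δ * (1 - r) * (1 / (1 - r)) := by
        refine mul_le_mul_of_nonneg_left ?_ (by positivity)
        rw [geom_sum_eq hr1.ne, ← neg_div_neg_eq]
        simp only [neg_sub]
        exact div_le_div_of_nonneg_right (by linarith [pow_pos hr0 (K - m)]) h1r.le
    _ = δ := by field_simp

end IsLacunaryMajorant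

theorem add_div_sub_le_exp {a b r ρ : ℝ} (ha : 0 ≤ a) (hb : 0 < b) (hab : a ≤ b * r) (hr : r ≤ ρ)
    (hρ : ρ < 1) : (a + b) / (b - a) ≤ Real.exp (2 / (1 - ρ) * r) := by
  have h1 : b * (1 - ρ) ≤ b - a := by nlinarith
  have h2 : 0 < b * (1 - ρ) := mul_pos hb (by linarith)
  have h3 : a / (b - a) ≤ r / (1 - ρ) := by
    rw [div_le_div_iff₀ (by linarith) (by linarith)]
    have hr0 : 0 ≤ r := by by_contra hc; nlinarith
    nlinarith
  have h4 : (a + b) / (b - a) = 2 * (a / (b - a)) + 1 := by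
    have : b - a ≠ 0 := by linarith
    field_simp; ring
  rw [h4]
  refine le_trans ?_ (Real.add_one_le_exp _)
  have : 2 / (1 - ρ) * r = 2 * (r / (1 - ρ)) := by ring
  rw [this]; linarith

theorem geom_sum_le_one_div {ρ : ℝ} (h0 : 0 ≤ ρ) (h1 : ρ < 1) (n : ℕ) :
    ∑ d ∈ Finset.range n, ρ ^ d ≤ 1 / (1 - ρ) := by
  rw [geom_sum_eq h1.ne, ← neg_div_neg_eq]
  simp only [neg_sub]
  exact div_le_div_of_nonneg_right (by linarith [pow_nonneg h0 n]) (by linarith)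

namespace IsLacunaryMajorant

variable {lam σ : ℕ → ℝ} {θ C : ℝ} (h : IsLacunaryMajorant lam σ θ C)
include h

/-- The factor at distance d from i is 1 + O(θ^(-d)), so the products on both sides of i converge
with bounds independent of i and m. -/
theorem prod_add_div_abs_sub_le (m i : ℕ) (hi : i < m) :
    ∏ l ∈ (Finset.range m).erase i, (σ i + σ l) / |σ i - σ l| ≤
      Real.exp (2 / (1 - 1 / θ) * (2 / (1 - 1 / θ))) := by
  have hθ := h.one_lt
  set ρ : ℝ := 1 / θ with hρ
  have hρ0 : 0 < ρ := by positivity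
  have hρ1 : ρ < 1 := by rw [hρ, div_lt_one (by linarith)]; exact hθ
  have hle : ∀ a d : ℕ, σ a ≤ σ (a + d) * ρ ^ d := by
    intro a d
    have := h.pow_mul_le a d
    rw [hρ, div_pow, one_pow, mul_one_div, le_div_iff₀ (by positivity)]
    linarith
  have hpos : ∀ a, 0 < σ a := fun a => by linarith [h.two_le a]
  have hsub : (Finset.range m).erase i = Finset.range i ∪ Finset.Ico (i + 1) m := by
    ext l; simp; omega
  have hdisj : Disjoint (Finset.range i) (Finset.Ico (i + 1) m) := by
    rw [Finset.disjoint_left]; intro l; simp; omega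
  have hρp : ∀ d, 1 ≤ d → ρ ^ d ≤ ρ := fun d hd => by
    simpa using pow_le_pow_of_le_one hρ0.le hρ1.le hd
  have b1 : ∏ l ∈ Finset.range i, (σ i + σ l) / |σ i - σ l| ≤
      Real.exp (2 / (1 - ρ) * (1 / (1 - ρ))) := by
    calc _ ≤ ∏ l ∈ Finset.range i, Real.exp (2 / (1 - ρ) * ρ ^ (i - l)) := by
          refine Finset.prod_le_prod (fun l _ => div_nonneg (by linarith [hpos i, hpos l])
            (abs_nonneg _)) fun l hl => ?_
          have hl := Finset.mem_range.1 hl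
          have e := hle l (i - l)
          rw [Nat.add_sub_cancel' hl.le] at e
          rw [abs_of_pos (by linarith [h.strictMono hl]), add_comm]
          exact add_div_sub_le_exp (hpos l).le (hpos i) e (hρp _ (by omega)) hρ1
      _ = Real.exp (2 / (1 - ρ) * ∑ l ∈ Finset.range i, ρ ^ (i - l)) := by
          rw [← Real.exp_sum, Finset.mul_sum]
      _ ≤ _ := by
          refine Real.exp_le_exp.2 (mul_le_mul_of_nonneg_left ?_
            (div_nonneg (by norm_num) (by linarith)))
          rw [← Finset.sum_range_reflect]
          refine le_trans (Finset.sum_le_sum fun l hl => ?_) (geom_sum_le_one_div hρ0.le hρ1 i)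
          have hl := Finset.mem_range.1 hl
          exact pow_le_pow_of_le_one hρ0.le hρ1.le (by omega)
  have b2 : ∏ l ∈ Finset.Ico (i + 1) m, (σ i + σ l) / |σ i - σ l| ≤
      Real.exp (2 / (1 - ρ) * (1 / (1 - ρ))) := by
    calc _ ≤ ∏ l ∈ Finset.Ico (i + 1) m, Real.exp (2 / (1 - ρ) * ρ ^ (l - i)) := by
          refine Finset.prod_le_prod (fun l _ => div_nonneg (by linarith [hpos i, hpos l])
            (abs_nonneg _)) fun l hl => ?_
          have hl := Finset.mem_Ico.1 hl
          have e := hle i (l - i)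
          rw [Nat.add_sub_cancel' (by omega)] at e
          rw [abs_sub_comm, abs_of_pos (by linarith [h.strictMono (show i < l by omega)])]
          exact add_div_sub_le_exp (hpos i).le (hpos l) e (hρp _ (by omega)) hρ1
      _ = Real.exp (2 / (1 - ρ) * ∑ l ∈ Finset.Ico (i + 1) m, ρ ^ (l - i)) := by
          rw [← Real.exp_sum, Finset.mul_sum]
      _ ≤ _ := by
          refine Real.exp_le_exp.2 (mul_le_mul_of_nonneg_left ?_
            (div_nonneg (by norm_num) (by linarith)))
          rw [Finset.sum_Ico_eq_sum_range]
          refine le_trans (Finset.sum_le_sum fun l _ => ?_)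
            (geom_sum_le_one_div hρ0.le hρ1 (m - (i + 1)))
          exact pow_le_pow_of_le_one hρ0.le hρ1.le (by omega)
  rw [hsub, Finset.prod_union hdisj]
  calc _ ≤ Real.exp (2 / (1 - ρ) * (1 / (1 - ρ))) * Real.exp (2 / (1 - ρ) * (1 / (1 - ρ))) :=
        mul_le_mul b1 b2 (Finset.prod_nonneg fun l _ => div_nonneg (by linarith [hpos i, hpos l])
            (abs_nonneg _)) (Real.exp_pos _).le
    _ = _ := by rw [← Real.exp_add]; congr 1; ring

/-- Partial fractions of `∏ (x - lam i) / (x + σ i)`: the residues are bounded by a multiple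
of the poles. -/
theorem exists_partialFractions : ∃ B : ℝ, 0 < B ∧ ∀ m : ℕ, ∃ c : ℕ → ℝ,
    (∀ i < m, |c i| ≤ B * σ i) ∧
    ∀ j < m, 1 + ∑ i ∈ Finset.range m, c i / (lam j + σ i) = 0 := by
  set B₀ := Real.exp (2 / (1 - 1 / θ) * (2 / (1 - 1 / θ)))
  have hpos : ∀ a, 0 < σ a := fun a => by linarith [h.two_le a]
  refine ⟨2 * B₀, by positivity, fun m => ?_⟩
  set s := Finset.range m
  set v : ℕ → ℝ := fun i => -σ i with hv
  have hinj : Set.InjOn v s := fun a _ b _ hab => h.strictMono.injective (neg_injective hab)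
  set P := Lagrange.nodal s lam
  -- These are the residues P(v_i) / ∏ (v_i - v_l) at the poles v_i = -σ_i.
  refine ⟨fun i => Lagrange.nodalWeight s v i * P.eval (v i), fun i hi => ?_, fun j hj => ?_⟩
  · have his : i ∈ s := Finset.mem_range.2 hi
    have e1 : |Lagrange.nodalWeight s v i| = ∏ l ∈ s.erase i, |σ i - σ l|⁻¹ := by
      rw [Lagrange.nodalWeight, Finset.abs_prod]
      refine Finset.prod_congr rfl fun l _ => ?_
      rw [abs_inv, hv, neg_sub_neg, abs_sub_comm]
    have e2 : |P.eval (v i)| = (σ i + lam i) * ∏ l ∈ s.erase i, (σ i + lam l) := by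
      rw [Lagrange.eval_nodal, Finset.abs_prod, ← Finset.mul_prod_erase s _ his]
      have : ∀ l, |v i - lam l| = σ i + lam l := fun l => by
        rw [hv, abs_of_neg (by linarith [hpos i, h.pos l])]; ring
      simp_rw [this]
    rw [abs_mul, e1, e2]
    calc _ = (σ i + lam i) * ∏ l ∈ s.erase i, (σ i + lam l) / |σ i - σ l| := by
          simp_rw [div_eq_mul_inv, Finset.prod_mul_distrib]; ring
      _ ≤ (2 * σ i) * ∏ l ∈ s.erase i, (σ i + σ l) / |σ i - σ l| := by
          refine mul_le_mul (by linarith [h.le i]) (Finset.prod_le_prod (fun l _ => ?_)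
            fun l _ => ?_) (Finset.prod_nonneg fun l _ => ?_) (by linarith [hpos i])
          · exact div_nonneg (by linarith [hpos i, h.pos l]) (abs_nonneg _)
          · exact div_le_div_of_nonneg_right (by linarith [h.le l]) (abs_nonneg _)
          · exact div_nonneg (by linarith [hpos i, h.pos l]) (abs_nonneg _)
      _ ≤ (2 * σ i) * B₀ :=
          mul_le_mul_of_nonneg_left (h.prod_add_div_abs_sub_le m i hi) (by linarith [hpos i])
      _ = _ := by ring
  -- The leading terms cancel in Q, which therefore equals its Lagrange interpolant at the poles. At
  -- a zero lam_j of P this is the partial fraction identity, with Q(v_i) = -P(v_i).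
  · set Q := Lagrange.nodal s v - P
    have hdeg : Q.degree < s.card := by
      rcases Nat.eq_zero_or_pos m with rfl | hm
      · omega
      have hd : (Lagrange.nodal s v).degree = s.card := Lagrange.degree_nodal
      rw [← hd]
      refine Polynomial.degree_sub_lt_left (by rw [hd]; exact Lagrange.degree_nodal.symm)
        Lagrange.nodal_ne_zero ?_
      rw [Lagrange.nodal_monic, Lagrange.nodal_monic]
    have hQ : Q = Lagrange.interpolate s v (fun i => Q.eval (v i)) :=
      Lagrange.eq_interpolate_of_eval_eq _ hinj hdeg fun i _ => rfl
    have hx : ∀ i ∈ s, lam j ≠ v i := fun i _ => by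
      have := hpos i; have := h.pos j; simp only [hv]; linarith
    have e1 := congrArg (Polynomial.eval (lam j)) hQ
    rw [Lagrange.eval_interpolate_not_at_node _ hx] at e1
    have e2 : Q.eval (lam j) = (Lagrange.nodal s v).eval (lam j) := by
      rw [Polynomial.eval_sub, Lagrange.eval_nodal_at_node (Finset.mem_range.2 hj), sub_zero]
    have e3 := Lagrange.eval_nodal_not_at_node hx
    rw [e2] at e1
    have e4 := mul_left_cancel₀ e3 ((mul_one _).trans e1)
    rw [e4, ← Finset.sum_add_distrib]
    refine Finset.sum_eq_zero fun i hi => ?_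
    rw [Polynomial.eval_sub, Lagrange.eval_nodal_at_node hi, div_eq_mul_inv, hv]
    simp only [sub_neg_eq_add]
    ring

end IsLacunaryMajorant

/-! ### Exponential sums and Müntz sums -/

/-- An exponential sum is small at the end of an interval on which it is bounded, if its
frequencies are large compared to the subdivision of the interval. -/
theorem norm_sum_exp_le (lam y : ℕ → ℝ) (hy : ∀ j, 0 ≤ y j) (S : Finset ℕ) :
    ∀ (b : ℕ → ℂ) (x B : ℝ), (∀ z ∈ Set.Icc x (x + ∑ j ∈ S, y j),
      ‖∑ j ∈ S, b j * (Real.exp (-(lam j * z)) : ℂ)‖ ≤ B) →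
    ‖∑ j ∈ S, b j * (Real.exp (-(lam j * (x + ∑ j ∈ S, y j))) : ℂ)‖ ≤
      (∏ j ∈ S, (1 + Real.exp (-(lam j * y j))) - 1) * B := by
  induction S using Finset.induction_on with
  | empty => intro b x B _; simp
  | insert i S hi ih =>
    intro b x B hB
    rw [Finset.prod_insert hi, Finset.sum_insert hi (f := y)]
    rw [Finset.sum_insert hi (f := y)] at hB
    set Y := ∑ j ∈ S, y j with hY
    have hY0 : 0 ≤ Y := Finset.sum_nonneg fun j _ => hy j
    set ε := Real.exp (-(lam i * y i)) with hε
    set h : ℝ → ℂ := fun z => ∑ j ∈ insert i S, b j * (Real.exp (-(lam j * z)) : ℂ) with hh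
    set b' : ℕ → ℂ := fun j => b j * ((Real.exp (-(lam j * y i)) - ε : ℝ) : ℂ)
    -- This difference kills the frequency lam_i and only rescales the other coefficients, at the
    -- cost of a factor 1 + ε in the supremum.
    have hT : ∀ z, h (z + y i) - (ε : ℂ) * h z =
        ∑ j ∈ S, b' j * (Real.exp (-(lam j * z)) : ℂ) := by
      intro z
      rw [hh]
      simp only [Finset.sum_insert hi]
      rw [mul_add (ε : ℂ), Finset.mul_sum, add_sub_add_comm, ← Finset.sum_sub_distrib]
      have e : ∀ j, Real.exp (-(lam j * (z + y i))) =
          Real.exp (-(lam j * y i)) * Real.exp (-(lam j * z)) := fun j => by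
        rw [← Real.exp_add]; congr 1; ring
      rw [e i, ← hε]
      have e0 : b i * ((ε * Real.exp (-(lam i * z)) : ℝ) : ℂ) -
          (ε : ℂ) * (b i * (Real.exp (-(lam i * z)) : ℂ)) = 0 := by push_cast; ring
      rw [e0, zero_add]
      refine Finset.sum_congr rfl fun j _ => ?_
      rw [e j]
      simp only [b']
      push_cast; ring
    have hBT : ∀ z ∈ Set.Icc x (x + Y),
        ‖∑ j ∈ S, b' j * (Real.exp (-(lam j * z)) : ℂ)‖ ≤ (1 + ε) * B := by
      intro z hz
      rw [← hT]
      have h1 := hB (z + y i) ⟨by linarith [hz.1, hy i], by linarith [hz.2]⟩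
      have h2 := hB z ⟨hz.1, by linarith [hz.2, hy i]⟩
      calc _ ≤ ‖h (z + y i)‖ + ‖(ε : ℂ) * h z‖ := norm_sub_le _ _
        _ ≤ B + ε * B := by
            rw [norm_mul, Complex.norm_real, Real.norm_of_nonneg (Real.exp_pos _).le]
            exact add_le_add h1 (mul_le_mul_of_nonneg_left h2 (Real.exp_pos _).le)
        _ = _ := by ring
    have h3 := ih b' x ((1 + ε) * B) hBT
    rw [← hT] at h3
    have h4 := hB (x + Y) ⟨by linarith, by linarith [hy i]⟩
    have h5 : h (x + (y i + Y)) = (h (x + Y + y i) - (ε : ℂ) * h (x + Y)) + ε * h (x + Y) := by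
      rw [sub_add_cancel]; congr 1; ring
    change ‖h (x + (y i + Y))‖ ≤ _
    rw [h5]
    calc _ ≤ ‖h (x + Y + y i) - (ε : ℂ) * h (x + Y)‖ + ‖(ε : ℂ) * h (x + Y)‖ := norm_add_le _ _
      _ ≤ (∏ j ∈ S, (1 + Real.exp (-(lam j * y j))) - 1) * ((1 + ε) * B) + ε * B := by
          refine add_le_add h3 ?_
          rw [norm_mul, Complex.norm_real, Real.norm_of_nonneg (Real.exp_pos _).le]
          exact mul_le_mul_of_nonneg_left h4 (Real.exp_pos _).le
      _ = _ := by ring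

/-- The Müntz polynomial `t ↦ ∑_{j < K} a_j t ^ lam_j`. -/
noncomputable def muntzSum (lam : ℕ → ℝ) (a : ℕ → ℂ) (K : ℕ) (t : ℝ) : ℂ :=
  ∑ j ∈ Finset.range K, a j * ((t ^ lam j : ℝ) : ℂ)

theorem continuous_muntzSum {lam : ℕ → ℝ} (hpos : ∀ i, 0 < lam i) (a : ℕ → ℂ) (K : ℕ) :
    Continuous (muntzSum lam a K) :=
  continuous_finsetSum _ fun j _ => continuous_const.mul
    (Complex.continuous_ofReal.comp (Real.continuous_rpow_const (hpos j).le))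

/-- After multiplication by t^(-s), this integral acts on t^lam_j as the multiplier 1/(lam_j + s),
which turns partial fractions into integral operators. -/
theorem integral_rpow_mul_muntzSum {lam : ℕ → ℝ} (hpos : ∀ i, 0 < lam i) (a : ℕ → ℂ) (K : ℕ)
    {s t : ℝ} (hs : 1 ≤ s) (ht : 0 < t) :
    ∫ u in (0 : ℝ)..t, ((u ^ (s - 1) : ℝ) : ℂ) * muntzSum lam a K u =
      ∑ j ∈ Finset.range K, a j * ((t ^ (s + lam j) / (lam j + s) : ℝ) : ℂ) := by
  have hcont : ∀ j, Continuous fun u : ℝ => ((u ^ (s - 1) : ℝ) : ℂ) * (a j * ((u ^ lam j : ℝ) : ℂ)) :=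
    fun j => (Complex.continuous_ofReal.comp (Real.continuous_rpow_const (by linarith))).mul
      (continuous_const.mul (Complex.continuous_ofReal.comp
        (Real.continuous_rpow_const (hpos j).le)))
  simp only [muntzSum, Finset.mul_sum]
  rw [intervalIntegral.integral_finsetSum fun j _ => (hcont j).intervalIntegrable _ _]
  refine Finset.sum_congr rfl fun j _ => ?_
  have h1 : ∫ u in (0 : ℝ)..t, ((u ^ (s - 1) : ℝ) : ℂ) * (a j * ((u ^ lam j : ℝ) : ℂ)) =
      ∫ u in (0 : ℝ)..t, a j * ((u ^ (s - 1 + lam j) : ℝ) : ℂ) := by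
    refine intervalIntegral.integral_congr_ae (Eventually.of_forall fun u hu => ?_)
    rw [Set.uIoc_of_le ht.le] at hu
    rw [Real.rpow_add hu.1]; push_cast; ring
  rw [h1, intervalIntegral.integral_const_mul, intervalIntegral.integral_ofReal,
    integral_rpow (Or.inl (by linarith [hpos j]))]
  have h2 : s - 1 + lam j + 1 = s + lam j := by ring
  rw [h2, Real.zero_rpow (by linarith [hpos j]), sub_zero, add_comm (lam j) s]

/-! ### Separation of frequencies and the local estimate -/

namespace IsLacunaryMajorant

variable {lam σ : ℕ → ℝ} {θ C : ℝ} (h : IsLacunaryMajorant lam σ θ C)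
include h

/-- The low frequencies are removed from a Müntz polynomial at the cost of an error
controlled by the values further away from `1`. -/
theorem exists_highPart : ∃ D : ℝ, 0 < D ∧ ∀ (m K : ℕ) (a : ℕ → ℂ), ∃ (b : ℕ → ℂ) (E : ℝ → ℂ),
    (∀ t, 0 < t → muntzSum lam a K t + E t =
      ∑ j ∈ Finset.Ico m K, b j * ((t ^ lam j : ℝ) : ℂ)) ∧
    ∀ (t G : ℝ), 0 < t → t < 1 → (∀ i < m, t ^ (-σ i) ≤ G) → 0 ≤ G →
      ‖E t‖ ≤ D * G * ∫ u in (0 : ℝ)..t, ‖muntzSum lam a K u‖ / (1 - u) := by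
  have hθ := h.one_lt
  obtain ⟨B, hB, hpf⟩ := h.exists_partialFractions
  have hσ : ∀ a, 0 < σ a := fun a => by linarith [h.two_le a]
  have hD : 0 < 2 * (θ / (θ - 1)) := by
    have : 0 < θ - 1 := by linarith
    positivity
  refine ⟨B * (2 * (θ / (θ - 1))), by positivity, fun m K a => ?_⟩
  obtain ⟨c, hc, hc0⟩ := hpf m
  set f := muntzSum lam a K with hf
  have hfc : Continuous f := continuous_muntzSum h.pos a K
  refine ⟨fun j => a j * ((1 + ∑ i ∈ Finset.range m, c i / (lam j + σ i) : ℝ) : ℂ),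
    fun t => ∑ i ∈ Finset.range m, ((c i * t ^ (-σ i) : ℝ) : ℂ) *
      ∫ u in (0 : ℝ)..t, ((u ^ (σ i - 1) : ℝ) : ℂ) * f u, fun t ht => ?_, ?_⟩
  · have e1 : ∑ j ∈ Finset.Ico m K, a j * ((1 + ∑ i ∈ Finset.range m, c i / (lam j + σ i) : ℝ) : ℂ)
        * ((t ^ lam j : ℝ) : ℂ) = ∑ j ∈ Finset.range K,
        a j * ((1 + ∑ i ∈ Finset.range m, c i / (lam j + σ i) : ℝ) : ℂ) * ((t ^ lam j : ℝ) : ℂ) := by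
      refine Finset.sum_subset (fun j hj => ?_) fun j hj hj' => ?_
      · simp at hj ⊢; omega
      · have : j < m := by simp at hj hj'; omega
        rw [hc0 j this]; simp
    rw [e1]
    have e2 : ∀ i ∈ Finset.range m, ((c i * t ^ (-σ i) : ℝ) : ℂ) *
        ∫ u in (0 : ℝ)..t, ((u ^ (σ i - 1) : ℝ) : ℂ) * f u =
        ∑ j ∈ Finset.range K, a j * ((c i / (lam j + σ i) : ℝ) : ℂ) * ((t ^ lam j : ℝ) : ℂ) := by
      intro i _
      rw [hf, integral_rpow_mul_muntzSum h.pos a K (by linarith [h.two_le i]) ht, Finset.mul_sum]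
      refine Finset.sum_congr rfl fun j _ => ?_
      have : (c i * t ^ (-σ i)) * (t ^ (σ i + lam j) / (lam j + σ i)) =
          c i / (lam j + σ i) * t ^ lam j := by
        have : t ^ lam j = t ^ (-σ i) * t ^ (σ i + lam j) := by
          rw [← Real.rpow_add ht]; congr 1; ring
        rw [this]; ring
      calc _ = a j * (((c i * t ^ (-σ i)) * (t ^ (σ i + lam j) / (lam j + σ i)) : ℝ) : ℂ) := by
            push_cast; ring
        _ = _ := by rw [this]; push_cast; ring
    beta_reduce
    rw [Finset.sum_congr rfl e2, Finset.sum_comm, hf, muntzSum, ← Finset.sum_add_distrib]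
    refine Finset.sum_congr rfl fun j _ => ?_
    rw [← Finset.sum_mul, ← Finset.mul_sum]
    push_cast; ring
  · intro t G ht ht1 hG hG0
    have hint : ∀ i, IntervalIntegrable (fun u : ℝ => u ^ (σ i - 1) * ‖f u‖) volume 0 t := fun i =>
      ((Real.continuous_rpow_const (by linarith [h.two_le i])).mul hfc.norm).intervalIntegrable _ _
    calc _ ≤ ∑ i ∈ Finset.range m, ‖((c i * t ^ (-σ i) : ℝ) : ℂ) *
          ∫ u in (0 : ℝ)..t, ((u ^ (σ i - 1) : ℝ) : ℂ) * f u‖ := norm_sum_le _ _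
      _ ≤ ∑ i ∈ Finset.range m, B * G * ∫ u in (0 : ℝ)..t, σ i * (u ^ (σ i - 1) * ‖f u‖) := by
          refine Finset.sum_le_sum fun i hi => ?_
          have hi := Finset.mem_range.1 hi
          rw [norm_mul, Complex.norm_real, Real.norm_eq_abs, abs_mul,
            abs_of_pos (Real.rpow_pos_of_pos ht _), intervalIntegral.integral_const_mul]
          have h1 : ‖∫ u in (0 : ℝ)..t, ((u ^ (σ i - 1) : ℝ) : ℂ) * f u‖ ≤
              ∫ u in (0 : ℝ)..t, u ^ (σ i - 1) * ‖f u‖ := by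
            refine intervalIntegral.norm_integral_le_of_norm_le ht.le
              (Eventually.of_forall fun u hu => ?_) (hint i)
            rw [norm_mul, Complex.norm_real, Real.norm_of_nonneg (Real.rpow_nonneg hu.1.le _)]
          calc _ ≤ (B * σ i * G) * ∫ u in (0 : ℝ)..t, u ^ (σ i - 1) * ‖f u‖ := by
                refine mul_le_mul (mul_le_mul (hc i hi) (hG i hi)
                  (Real.rpow_pos_of_pos ht _).le (mul_pos hB (hσ i)).le) h1 (norm_nonneg _) ?_
                exact mul_nonneg (mul_pos hB (hσ i)).le hG0
            _ = _ := by ring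
      _ = B * G * ∫ u in (0 : ℝ)..t, ∑ i ∈ Finset.range m, σ i * (u ^ (σ i - 1) * ‖f u‖) := by
          rw [← Finset.mul_sum, intervalIntegral.integral_finsetSum fun i _ =>
            (hint i).const_mul _]
      _ ≤ B * G * ∫ u in (0 : ℝ)..t, 2 * (θ / (θ - 1)) * (‖f u‖ / (1 - u)) := by
          refine mul_le_mul_of_nonneg_left ?_ (mul_nonneg hB.le hG0)
          refine intervalIntegral.integral_mono_on_of_le_Ioo ht.le ?_ ?_ fun u hu => ?_
          · simpa only [Finset.sum_fn] using
              IntervalIntegrable.sum (Finset.range m) fun i _ => (hint i).const_mul (σ i)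
          · refine ContinuousOn.intervalIntegrable ?_
            refine continuousOn_const.mul (hfc.norm.continuousOn.div
              (continuousOn_const.sub continuousOn_id) fun u hu => ?_)
            rw [Set.uIcc_of_le ht.le] at hu
            have := hu.2
            linarith
          · have e : ∑ i ∈ Finset.range m, σ i * (u ^ (σ i - 1) * ‖f u‖) =
                (∑ i ∈ Finset.range m, σ i * u ^ (σ i - 1)) * ‖f u‖ := by
              rw [Finset.sum_mul]; exact Finset.sum_congr rfl fun i _ => by ring
            rw [e]
            refine (mul_le_mul_of_nonneg_right (h.sum_mul_rpow_le hu.1 (hu.2.trans ht1) m)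
              (norm_nonneg _)).trans (le_of_eq (by ring))
      _ = _ := by rw [intervalIntegral.integral_const_mul]; ring

theorem tendsto_atTop : Tendsto lam atTop atTop := by
  have h1 : Tendsto (fun i => θ ^ i * σ 0) atTop atTop :=
    (tendsto_pow_atTop_atTop_of_one_lt h.one_lt).atTop_mul_const (by linarith [h.two_le 0])
  have h2 : Tendsto (fun i => C * lam i) atTop atTop :=
    tendsto_atTop_mono (fun i => ((h.pow_mul_le 0 i).trans_eq (by rw [zero_add])).trans
      (h.le_mul i)) h1
  exact (tendsto_const_mul_atTop_of_pos h.const_pos).1 h2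

/-- The value of a Müntz polynomial at `T` is controlled by a small multiple of its supremum
slightly to the right of `T`, and by an integral mean over the left. -/
theorem exists_norm_muntzSum_le {η : ℝ} (hη : 0 < η) : ∃ D : ℝ, 0 < D ∧
    ∀ (a : ℕ → ℂ) (K : ℕ) (T M : ℝ), 0 < T → T < 1 →
      (∀ t ∈ Set.Icc T (Real.sqrt T), ‖muntzSum lam a K t‖ ≤ M) →
      ‖muntzSum lam a K T‖ ≤
        η * M + D * ∫ u in (0 : ℝ)..Real.sqrt T, ‖muntzSum lam a K u‖ / (1 - u) := by
  obtain ⟨D, hD, hpart⟩ := h.exists_highPart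
  have hlog : 0 < Real.log (1 + η) := Real.log_pos (by linarith)
  obtain ⟨A, hA, hsum⟩ := h.exists_sum_inv_sqrt_le
    (δ := min (1 / 2) (Real.log (1 + η))) (lt_min (by norm_num) hlog)
  -- Low frequencies satisfy lam_i X < A, hence T^(-σ_i) = exp(σ_i X) ≤ exp(C A).
  set G := Real.exp (C * A) with hGdef
  have hG : 0 < G := Real.exp_pos _
  refine ⟨(1 + η) * (D * G), by positivity, fun a K T M hT hT1 hM => ?_⟩
  set X := -Real.log T with hX
  have hX0 : 0 < X := by have := Real.log_neg hT hT1; linarith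
  have hTX : Real.exp (-X) = T := by rw [hX, neg_neg, Real.exp_log hT]
  have hsT : Real.exp (-(X / 2)) = Real.sqrt T := by
    rw [← hTX, ← Real.exp_half]; congr 1; ring
  obtain ⟨m, hm, hmlt⟩ : ∃ m, A ≤ lam m * X ∧ ∀ i < m, ¬ A ≤ lam i * X := by
    classical
    have hex : ∃ m, A ≤ lam m * X := by
      obtain ⟨m, hm⟩ := (h.tendsto_atTop.eventually_ge_atTop (A / X)).exists
      exact ⟨m, by rwa [div_le_iff₀ hX0] at hm⟩
    exact ⟨Nat.find hex, Nat.find_spec hex, fun l hl => Nat.find_min hex hl⟩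
  obtain ⟨b, E, hbE, hE⟩ := hpart m K a
  set f := muntzSum lam a K with hf
  have hfc : Continuous f := continuous_muntzSum h.pos a K
  set I := ∫ u in (0 : ℝ)..Real.sqrt T, ‖f u‖ / (1 - u) with hI
  have hsT1 : Real.sqrt T < 1 := by rw [Real.sqrt_lt' one_pos]; simpa using hT1
  have hEI : ∀ t ∈ Set.Icc T (Real.sqrt T), ‖E t‖ ≤ D * G * I := by
    intro t ht
    have ht0 : 0 < t := hT.trans_le ht.1
    refine (hE t G ht0 (ht.2.trans_lt hsT1) (fun i hi => ?_) hG.le).trans ?_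
    · have h1 := hmlt i hi
      push Not at h1
      calc t ^ (-σ i) ≤ T ^ (-σ i) :=
            Real.rpow_le_rpow_of_nonpos hT ht.1 (by linarith [h.two_le i])
        _ = Real.exp (σ i * X) := by rw [Real.rpow_def_of_pos hT, hX]; congr 1; ring
        _ ≤ G := by
            refine Real.exp_le_exp.2 ?_
            nlinarith [h.le_mul i, h.const_pos]
    · refine mul_le_mul_of_nonneg_left ?_ (by positivity)
      refine intervalIntegral.integral_mono_interval le_rfl ht0.le ht.2 ?_ ?_
      · refine (ae_restrict_iff' measurableSet_Ioc).2 (Eventually.of_forall fun u hu => ?_)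
        exact div_nonneg (norm_nonneg _) (by linarith [hu.2])
      · refine ContinuousOn.intervalIntegrable (hfc.norm.continuousOn.div
          (continuousOn_const.sub continuousOn_id) fun u hu => ?_)
        rw [Set.uIcc_of_le (Real.sqrt_nonneg T)] at hu
        have := hu.2
        linarith
  set S := Finset.Ico m K
  -- With this choice lam_j y_j = √(lam_j X). The single small sum ∑ 1/√(lam_j X) then bounds both
  -- the total length by X/2 and, through exp(-x) ≤ 1/x, the product by 1 + η.
  set y : ℕ → ℝ := fun j => X * (1 / Real.sqrt (lam j * X)) with hy
  have hs := hsum X hX0 m K hm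
  have hY : ∑ j ∈ S, y j ≤ X / 2 := by
    rw [hy, ← Finset.mul_sum]
    have := hs.trans (min_le_left _ _)
    nlinarith
  have hy0 : ∀ j, 0 ≤ y j := fun j => by positivity
  have hprod : ∏ j ∈ S, (1 + Real.exp (-(lam j * y j))) - 1 ≤ η := by
    have h1 : ∀ j, Real.exp (-(lam j * y j)) ≤ 1 / Real.sqrt (lam j * X) := by
      intro j
      have hp : 0 < lam j * X := mul_pos (h.pos j) hX0
      have e : lam j * y j = Real.sqrt (lam j * X) := by
        rw [hy]
        calc _ = (lam j * X) / Real.sqrt (lam j * X) := by ring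
          _ = _ := Real.div_sqrt
      rw [e, Real.exp_neg, ← one_div]
      exact one_div_le_one_div_of_le (Real.sqrt_pos.2 hp)
        (by linarith [Real.add_one_le_exp (Real.sqrt (lam j * X))])
    have h2 : ∏ j ∈ S, (1 + Real.exp (-(lam j * y j))) ≤
        Real.exp (∑ j ∈ S, 1 / Real.sqrt (lam j * X)) := by
      rw [Real.exp_sum]
      refine Finset.prod_le_prod (fun j _ => by positivity) fun j _ => ?_
      linarith [h1 j, Real.add_one_le_exp (1 / Real.sqrt (lam j * X))]
    have h3 := Real.exp_le_exp.2 (hs.trans (min_le_right _ _))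
    rw [Real.exp_log (by linarith)] at h3
    linarith
  have hexp : ∀ z j, Real.exp (-(lam j * z)) = Real.exp (-z) ^ lam j := fun z j => by
    rw [← Real.exp_mul]; congr 1; ring
  have hb : ∀ z, ∑ j ∈ S, b j * (Real.exp (-(lam j * z)) : ℂ) =
      f (Real.exp (-z)) + E (Real.exp (-z)) := fun z => by
    rw [hbE _ (Real.exp_pos _)]
    refine Finset.sum_congr rfl fun j _ => ?_
    rw [hexp]
  -- The interval [x, X] lies in [X/2, X], which t = exp(-z) maps onto [T, √T].
  set x := X - ∑ j ∈ S, y j with hx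
  have hxX : x + ∑ j ∈ S, y j = X := by rw [hx]; ring
  have hB := norm_sum_exp_le lam y hy0 S b x (M + D * G * I) (fun z hz => by
    rw [hxX] at hz
    have hz' : Real.exp (-z) ∈ Set.Icc T (Real.sqrt T) := by
      rw [← hsT, ← hTX]
      exact ⟨Real.exp_le_exp.2 (by linarith [hz.2]), Real.exp_le_exp.2 (by linarith [hz.1])⟩
    rw [hb]
    exact (norm_add_le _ _).trans (add_le_add (hM _ hz') (hEI _ hz')))
  rw [hxX, hb, hTX] at hB
  have hTm : T ∈ Set.Icc T (Real.sqrt T) := by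
    refine ⟨le_rfl, ?_⟩
    rw [← hsT, ← hTX]; exact Real.exp_le_exp.2 (by linarith)
  have hM0 : 0 ≤ M + D * G * I := (add_nonneg (norm_nonneg _) (norm_nonneg _)).trans
    (add_le_add (hM T hTm) (hEI T hTm))
  have h1 : ‖f T‖ ≤ ‖f T + E T‖ + ‖E T‖ := by
    simpa using norm_sub_le (f T + E T) (E T)
  have h2 := hEI T hTm
  have h3 := mul_le_mul_of_nonneg_right hprod hM0
  calc _ ≤ η * (M + D * G * I) + D * G * I := by linarith
    _ = _ := by ring

end IsLacunaryMajorant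

/-! ### Hölder estimates and the pointwise kernel bound -/

/-- Hölder's inequality for the splitting w g = (w g^p)^(1/p) w^(1-1/p). -/
theorem lintegral_mul_rpow_le {X : Type*} [MeasurableSpace X] {ν : Measure X} {w g : X → ℝ≥0∞}
    (hw : Measurable w) (hg : Measurable g) {p : ℝ} (hp : 1 ≤ p) :
    (∫⁻ x, w x * g x ∂ν) ^ p ≤ (∫⁻ x, w x ∂ν) ^ (p - 1) * ∫⁻ x, w x * g x ^ p ∂ν := by
  have hp0 : 0 < p := by linarith
  have h1 : 1 / p ≤ 1 := by rw [div_le_one hp0]; exact hp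
  have h2 := ENNReal.lintegral_mul_norm_pow_le (μ := ν) (f := fun x => w x * g x ^ p) (g := w)
    (hw.mul (hg.pow_const p)).aemeasurable hw.aemeasurable (p := 1 / p) (q := 1 - 1 / p)
    (by positivity) (by linarith) (by ring)
  have h3 : ∀ x, (w x * g x ^ p) ^ (1 / p) * w x ^ (1 - 1 / p) = w x * g x := by
    intro x
    rw [ENNReal.mul_rpow_of_nonneg _ _ (by positivity), ← ENNReal.rpow_mul,
      mul_one_div_cancel hp0.ne', ENNReal.rpow_one, mul_right_comm,
      ← ENNReal.rpow_add_of_nonneg _ _ (by positivity) (by linarith), add_sub_cancel,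
      ENNReal.rpow_one]
  simp_rw [h3] at h2
  refine (ENNReal.rpow_le_rpow h2 hp0.le).trans (le_of_eq ?_)
  rw [ENNReal.mul_rpow_of_nonneg _ _ hp0.le, ← ENNReal.rpow_mul, ← ENNReal.rpow_mul,
    one_div_mul_cancel hp0.ne', ENNReal.rpow_one, mul_comm]
  congr 2
  field_simp

theorem lintegral_one_sub_rpow_le {κ r : ℝ} (hκ : 0 < κ) (hr0 : 0 ≤ r) (hr : r < 1) :
    ∫⁻ u in Set.Ioo 0 r, ENNReal.ofReal ((1 - u) ^ (-1 - κ)) ≤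
      ENNReal.ofReal ((1 - r) ^ (-κ) / κ) := by
  have hcont : ContinuousOn (fun u : ℝ => (1 - u) ^ (-1 - κ)) (Set.uIcc 0 r) := by
    refine ContinuousOn.rpow_const (continuousOn_const.sub continuousOn_id) fun u hu => Or.inl ?_
    rw [Set.uIcc_of_le hr0] at hu
    have := hu.2
    exact (sub_pos.2 (this.trans_lt hr)).ne'
  have hint := hcont.intervalIntegrable (μ := volume)
  rw [restrict_Ioo_eq_restrict_Ioc, ← ofReal_integral_eq_lintegral_ofReal]
  · refine ENNReal.ofReal_le_ofReal ?_
    rw [← intervalIntegral.integral_of_le hr0,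
      intervalIntegral.integral_comp_sub_left (fun x => x ^ (-1 - κ)) 1,
      integral_rpow (Or.inr ⟨by linarith, by
        rw [Set.uIcc_of_le (by linarith)]; intro hc; linarith [hc.1]⟩)]
    have : -1 - κ + 1 = -κ := by ring
    rw [this, sub_zero, Real.one_rpow, div_neg, ← neg_div, neg_sub]
    exact div_le_div_of_nonneg_right (by linarith) hκ.le
  · exact (intervalIntegrable_iff_integrableOn_Ioc_of_le hr0).1 hint
  · refine (ae_restrict_iff' measurableSet_Ioc).2 (Eventually.of_forall fun u hu => ?_)
    exact Real.rpow_nonneg (by linarith [hu.2]) _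

theorem half_one_sub_le_one_sub_sqrt {T : ℝ} (hT : 0 ≤ T) : (1 - T) / 2 ≤ 1 - Real.sqrt T := by
  nlinarith [Real.sq_sqrt hT, sq_nonneg (1 - Real.sqrt T)]

theorem measurable_ofReal_one_sub_rpow (κ : ℝ) :
    Measurable fun u : ℝ => ENNReal.ofReal ((1 - u) ^ κ) := by fun_prop

/-- Hölder's inequality for the mean over `[0, √T]` with respect to `du / (1 - u)`. -/
theorem lintegral_div_one_sub_rpow_le {α s : ℝ} (hα : 0 < α) (hs : 1 ≤ s) :
    ∃ D : ℝ≥0∞, D ≠ ⊤ ∧ ∀ (F : ℝ → ℝ≥0∞) (T : ℝ), Measurable F → 0 < T → T < 1 →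
      (∫⁻ u in Set.Ioo 0 (Real.sqrt T), F u * ENNReal.ofReal (1 / (1 - u))) ^ s ≤
        D * ENNReal.ofReal ((1 - T) ^ (-(α / 2))) *
          ∫⁻ u in Set.Ioo 0 (Real.sqrt T), F u ^ s * ENNReal.ofReal ((1 - u) ^ (α / 2 - 1)) := by
  have hs0 : 0 < s := by linarith
  -- Splitting 1/(1-u) as (1-u)^(-1-κ) (1-u)^κ makes the first integral converge at 0 and behave
  -- like a power of 1-T; κ s = α/2 leaves half of the weight exponent to spare.
  set κ := α / (2 * s) with hκd
  have hκ : 0 < κ := by positivity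
  have hκs : κ * s = α / 2 := by rw [hκd]; field_simp
  refine ⟨ENNReal.ofReal ((1 / κ) ^ (s - 1) * 2 ^ (α / 2)), ENNReal.ofReal_ne_top,
    fun F T hF hT hT1 => ?_⟩
  have hr : Real.sqrt T < 1 := by rw [Real.sqrt_lt' one_pos]; simpa using hT1
  have hV := half_one_sub_le_one_sub_sqrt hT.le
  have hV0 : 0 < (1 - T) / 2 := by linarith
  have e1 : ∫⁻ u in Set.Ioo 0 (Real.sqrt T), F u * ENNReal.ofReal (1 / (1 - u)) =
      ∫⁻ u in Set.Ioo 0 (Real.sqrt T), ENNReal.ofReal ((1 - u) ^ (-1 - κ)) *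
        (F u * ENNReal.ofReal ((1 - u) ^ κ)) := by
    refine setLIntegral_congr_fun measurableSet_Ioo fun u hu => ?_
    have hu1 : 0 < 1 - u := by linarith [hu.2]
    rw [mul_left_comm, ← ENNReal.ofReal_mul (Real.rpow_nonneg hu1.le _), ← Real.rpow_add hu1]
    congr 2
    rw [show -1 - κ + κ = -1 by ring, Real.rpow_neg_one, one_div]
  rw [e1]
  refine (lintegral_mul_rpow_le (measurable_ofReal_one_sub_rpow _)
    (hF.mul (measurable_ofReal_one_sub_rpow _)) hs).trans ?_
  have h2 : ∫⁻ u in Set.Ioo 0 (Real.sqrt T), ENNReal.ofReal ((1 - u) ^ (-1 - κ)) *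
        (F u * ENNReal.ofReal ((1 - u) ^ κ)) ^ s ≤ ENNReal.ofReal (((1 - T) / 2) ^ (-κ)) *
      ∫⁻ u in Set.Ioo 0 (Real.sqrt T), F u ^ s * ENNReal.ofReal ((1 - u) ^ (α / 2 - 1)) := by
    rw [← lintegral_const_mul' _ _ ENNReal.ofReal_ne_top]
    refine setLIntegral_mono' measurableSet_Ioo fun u hu => ?_
    have hu1 : 0 < 1 - u := by linarith [hu.2]
    rw [ENNReal.mul_rpow_of_nonneg _ _ hs0.le,
      ENNReal.ofReal_rpow_of_nonneg (Real.rpow_nonneg hu1.le _) hs0.le, ← Real.rpow_mul hu1.le,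
      hκs, mul_left_comm, mul_left_comm (ENNReal.ofReal _),
      ← ENNReal.ofReal_mul (Real.rpow_nonneg hu1.le _),
      ← ENNReal.ofReal_mul (Real.rpow_nonneg hV0.le _), ← Real.rpow_add hu1]
    refine mul_le_mul_right (ENNReal.ofReal_le_ofReal ?_) _
    rw [show -1 - κ + α / 2 = -κ + (α / 2 - 1) by ring, Real.rpow_add hu1]
    refine mul_le_mul_of_nonneg_right ?_ (Real.rpow_nonneg hu1.le _)
    exact Real.rpow_le_rpow_of_nonpos hV0 (by linarith [hu.2]) (by linarith)
  have h3 : (∫⁻ u in Set.Ioo 0 (Real.sqrt T), ENNReal.ofReal ((1 - u) ^ (-1 - κ))) ^ (s - 1) ≤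
      ENNReal.ofReal ((1 / κ * ((1 - T) / 2) ^ (-κ)) ^ (s - 1)) := by
    rw [← ENNReal.ofReal_rpow_of_nonneg (by positivity) (by linarith)]
    refine ENNReal.rpow_le_rpow ((lintegral_one_sub_rpow_le hκ (Real.sqrt_nonneg T) hr).trans
      (ENNReal.ofReal_le_ofReal ?_)) (by linarith)
    rw [one_div_mul_eq_div]
    exact div_le_div_of_nonneg_right (Real.rpow_le_rpow_of_nonpos hV0 hV (by linarith)) hκ.le
  refine (mul_le_mul' h3 h2).trans (le_of_eq ?_)
  rw [← mul_assoc, ← ENNReal.ofReal_mul (by positivity), ← ENNReal.ofReal_mul (by positivity)]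
  congr 2
  rw [Real.mul_rpow (by positivity) (by positivity), ← Real.rpow_mul hV0.le, mul_assoc,
    ← Real.rpow_add hV0, show -κ * (s - 1) + -κ = -(α / 2) by rw [← hκs]; ring,
    Real.div_rpow (show 0 ≤ 1 - T by linarith) (by norm_num),
    Real.rpow_neg (by norm_num : (0 : ℝ) ≤ 2), div_inv_eq_mul]
  ring

theorem ofReal_integral_norm_div_one_sub {f : ℝ → ℂ} (hf : Continuous f) {r : ℝ} (hr0 : 0 ≤ r)
    (hr : r < 1) : ENNReal.ofReal (∫ u in (0 : ℝ)..r, ‖f u‖ / (1 - u)) =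
      ∫⁻ u in Set.Ioo 0 r, ‖f u‖ₑ * ENNReal.ofReal (1 / (1 - u)) := by
  rw [intervalIntegral.integral_of_le hr0, restrict_Ioo_eq_restrict_Ioc,
    ofReal_integral_eq_lintegral_ofReal]
  · refine lintegral_congr fun u => ?_
    rw [← ofReal_norm, ← ENNReal.ofReal_mul (norm_nonneg _), mul_one_div]
  · refine (intervalIntegrable_iff_integrableOn_Ioc_of_le hr0).1 (ContinuousOn.intervalIntegrable
      (hf.norm.continuousOn.div (continuousOn_const.sub continuousOn_id) fun u hu => ?_))
    rw [Set.uIcc_of_le hr0] at hu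
    exact (sub_pos.2 (hu.2.trans_lt hr)).ne'
  · refine (ae_restrict_iff' measurableSet_Ioc).2 (Eventually.of_forall fun u hu => ?_)
    exact div_nonneg (norm_nonneg _) (by linarith [hu.2])

theorem norm_muntzSum_le {lam : ℕ → ℝ} (hpos : ∀ i, 0 < lam i) (a : ℕ → ℂ) (K : ℕ) {t : ℝ}
    (ht0 : 0 ≤ t) (ht1 : t ≤ 1) : ‖muntzSum lam a K t‖ ≤ ∑ j ∈ Finset.range K, ‖a j‖ := by
  refine (norm_sum_le _ _).trans (Finset.sum_le_sum fun j _ => ?_)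
  rw [norm_mul, Complex.norm_real, Real.norm_of_nonneg (Real.rpow_nonneg ht0 _)]
  exact mul_le_of_le_one_right (norm_nonneg _) (Real.rpow_le_one ht0 ht1 (hpos j).le)

/-- The kernel that dominates point evaluations of Müntz polynomials, multiplied by
`V ^ (2 α)`; here `V` and `v` stand for distances to `1`. -/
noncomputable def muntzKernel (α V v : ℝ) : ℝ := min (V ^ (3 * α / 2) * v ^ (-(α / 2))) (v ^ α)

/-- Passing from V = 1-t to W = 1-T makes the kernel independent of the point t ∈ [T, 1) over which
the supremum is taken. The v^α alternative comes from u ≤ √t, that is, V ≤ 2v. -/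
theorem rpow_mul_le_muntzKernel {α V W v : ℝ} (hα : 0 < α) (hV : 0 < V) (hVW : V ≤ W)
    (hv : 0 < v) (hVv : V ≤ 2 * v) :
    V ^ (3 * α / 2) * v ^ (-(α / 2)) ≤ 2 ^ (3 * α / 2) * muntzKernel α W v := by
  have h1 : (1 : ℝ) ≤ 2 ^ (3 * α / 2) := Real.one_le_rpow (by norm_num) (by positivity)
  have hp : 0 < v ^ (-(α / 2)) := Real.rpow_pos_of_pos hv _
  rw [muntzKernel, mul_min_of_nonneg _ _ (by positivity)]
  refine le_min ?_ ?_
  · have h2 : V ^ (3 * α / 2) ≤ W ^ (3 * α / 2) := Real.rpow_le_rpow hV.le hVW (by positivity)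
    have h3 : 0 ≤ W ^ (3 * α / 2) * v ^ (-(α / 2)) :=
      mul_nonneg (Real.rpow_nonneg (hV.le.trans hVW) _) hp.le
    calc _ ≤ W ^ (3 * α / 2) * v ^ (-(α / 2)) := mul_le_mul_of_nonneg_right h2 hp.le
      _ ≤ _ := le_mul_of_one_le_left h3 h1
  · calc _ ≤ (2 * v) ^ (3 * α / 2) * v ^ (-(α / 2)) :=
          mul_le_mul_of_nonneg_right (Real.rpow_le_rpow hV.le hVv (by positivity)) hp.le
      _ = _ := by
          rw [Real.mul_rpow (by norm_num) hv.le, mul_assoc, ← Real.rpow_add hv]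
          congr 2; ring

theorem measurable_muntzKernel (α : ℝ) :
    Measurable fun x : ℝ × ℝ => ENNReal.ofReal (muntzKernel α (1 - x.1) (1 - x.2)) := by
  unfold muntzKernel; fun_prop

/-- Pointwise domination of a Müntz polynomial by an integral operator with positive kernel. -/
theorem IsLacunaryMajorant.exists_enorm_muntzSum_rpow_le {lam σ : ℕ → ℝ} {θ C : ℝ}
    (h : IsLacunaryMajorant lam σ θ C) {α s : ℝ} (hα : 0 < α) (hs : 1 ≤ s) :
    ∃ D : ℝ≥0∞, D ≠ ⊤ ∧ ∀ (a : ℕ → ℂ) (K : ℕ) (T : ℝ), 0 < T → T < 1 →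
      ‖muntzSum lam a K T‖ₑ ^ s * ENNReal.ofReal ((1 - T) ^ (2 * α)) ≤
        D * ∫⁻ u in Set.Ioo (0 : ℝ) 1, ‖muntzSum lam a K u‖ₑ ^ s *
          ENNReal.ofReal ((1 - u) ^ (α - 1)) *
          ENNReal.ofReal (muntzKernel α (1 - T) (1 - u)) := by
  have hs0 : 0 < s := by linarith
  -- Chosen so that, after the convexity constant 2^(s-1) and the loss 2^(2α) from 1-√t ≥ (1-t)/2,
  -- the supremum returns with factor 1/2.
  set η : ℝ := (2 ^ (s - 1) * 2 ^ (2 * α) * 2)⁻¹ ^ (1 / s) with hη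
  have hη0 : 0 < η := by positivity
  have hηs : 2 ^ (s - 1) * (η ^ s * 2 ^ (2 * α)) = 1 / 2 := by
    rw [hη, ← Real.rpow_mul (by positivity), one_div_mul_cancel hs0.ne', Real.rpow_one]
    field_simp
  obtain ⟨D₁, hD₁, hloc⟩ := h.exists_norm_muntzSum_le hη0
  obtain ⟨D₂, hD₂, hhol⟩ := lintegral_div_one_sub_rpow_le hα hs
  set D₃ : ℝ≥0∞ := 2 ^ (s - 1) * (ENNReal.ofReal D₁ ^ s *
    (D₂ * ENNReal.ofReal (2 ^ (3 * α / 2)))) with hD₃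
  have hD₃t : D₃ ≠ ⊤ := by
    refine ENNReal.mul_ne_top (ENNReal.rpow_ne_top_of_nonneg (by linarith) (by simp))
      (ENNReal.mul_ne_top (ENNReal.rpow_ne_top_of_nonneg hs0.le ENNReal.ofReal_ne_top)
      (ENNReal.mul_ne_top hD₂ ENNReal.ofReal_ne_top))
  refine ⟨2 * D₃ + 1, by finiteness, fun a K T hT hT1 => ?_⟩
  set f := muntzSum lam a K with hf
  have hfc : Continuous f := continuous_muntzSum h.pos a K
  set Q := ∫⁻ u in Set.Ioo (0 : ℝ) 1, ‖f u‖ₑ ^ s * ENNReal.ofReal ((1 - u) ^ (α - 1)) *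
          ENNReal.ofReal (muntzKernel α (1 - T) (1 - u)) with hQ
  rcases eq_or_ne Q ⊤ with hQt | hQt
  · rw [hQt, ENNReal.mul_top (by simp)]; exact le_top
  set g : ℝ → ℝ := fun t => ‖f t‖ ^ s * (1 - t) ^ (2 * α) with hg
  -- Finiteness of the supremum is what allows it to be absorbed; only its existence matters, not
  -- its size.
  have hbdd : BddAbove (g '' Set.Ico T 1) := by
    refine ⟨(∑ j ∈ Finset.range K, ‖a j‖) ^ s, ?_⟩
    rintro _ ⟨t, ht, rfl⟩
    have h1 := norm_muntzSum_le h.pos a K (hT.le.trans ht.1) ht.2.le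
    calc _ ≤ (∑ j ∈ Finset.range K, ‖a j‖) ^ s * 1 := by
          refine mul_le_mul (Real.rpow_le_rpow (norm_nonneg _) h1 hs0.le)
            (Real.rpow_le_one (by linarith [ht.2]) (by linarith [ht.1]) (by positivity))
            (Real.rpow_nonneg (by linarith [ht.2]) _) (by positivity)
      _ = _ := mul_one _
  set m := sSup (g '' Set.Ico T 1) with hm
  have hgm : ∀ t ∈ Set.Ico T 1, g t ≤ m := fun t ht => le_csSup hbdd ⟨t, ht, rfl⟩
  have hTm : T ∈ Set.Ico T 1 := ⟨le_rfl, hT1⟩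
  have hm0 : 0 ≤ m := le_trans (mul_nonneg (Real.rpow_nonneg (norm_nonneg _) _)
    (Real.rpow_nonneg (by linarith) _)) (hgm T hTm)
  have hstep : ∀ t ∈ Set.Ico T 1, ENNReal.ofReal (g t) ≤ ENNReal.ofReal (m / 2) + D₃ * Q := by
    intro t ht
    have ht0 : 0 < t := hT.trans_le ht.1
    have hV0 : 0 < 1 - t := by linarith [ht.2]
    have hst : Real.sqrt t < 1 := by rw [Real.sqrt_lt' one_pos]; simpa using ht.2
    have hVs := half_one_sub_le_one_sub_sqrt ht0.le
    set B : ℝ := (m * 2 ^ (2 * α) * (1 - t) ^ (-(2 * α))) ^ (1 / s) with hB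
    have hBs : B ^ s = m * 2 ^ (2 * α) * (1 - t) ^ (-(2 * α)) := by
      rw [hB, ← Real.rpow_mul (by positivity), one_div_mul_cancel hs0.ne', Real.rpow_one]
    have hB0 : 0 ≤ B := by positivity
    have hfB : ∀ t' ∈ Set.Icc t (Real.sqrt t), ‖f t'‖ ≤ B := by
      intro t' ht'
      refine (Real.rpow_le_rpow_iff (norm_nonneg _) hB0 hs0).1 ?_
      have h1 := hgm t' ⟨ht.1.trans ht'.1, ht'.2.trans_lt hst⟩
      have h2 : ((1 - t) / 2) ^ (2 * α) ≤ (1 - t') ^ (2 * α) :=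
        Real.rpow_le_rpow (by linarith) (by linarith [ht'.2]) (by positivity)
      have h3 : ‖f t'‖ ^ s * ((1 - t) / 2) ^ (2 * α) ≤ m :=
        (mul_le_mul_of_nonneg_left h2 (by positivity)).trans h1
      rw [hBs, Real.rpow_neg hV0.le, ← div_eq_mul_inv, le_div_iff₀ (by positivity)]
      rw [Real.div_rpow hV0.le (by norm_num), ← mul_div_assoc, div_le_iff₀ (by positivity)] at h3
      exact h3
    have h1 := hloc a K t B ht0 ht.2 hfB
    set I := ∫⁻ u in Set.Ioo 0 (Real.sqrt t), ‖f u‖ₑ * ENNReal.ofReal (1 / (1 - u)) with hI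
    have h2 : ‖f t‖ₑ ≤ ENNReal.ofReal (η * B) + ENNReal.ofReal D₁ * I := by
      rw [← ofReal_norm, hI, ← ofReal_integral_norm_div_one_sub hfc (Real.sqrt_nonneg t)
        hst, ← ENNReal.ofReal_mul hD₁.le]
      exact (ENNReal.ofReal_le_ofReal h1).trans ENNReal.ofReal_add_le
    have h3 : ‖f t‖ₑ ^ s ≤ 2 ^ (s - 1) * (ENNReal.ofReal (η * B) ^ s +
        (ENNReal.ofReal D₁ * I) ^ s) :=
      (ENNReal.rpow_le_rpow h2 hs0.le).trans (ENNReal.rpow_add_le_mul_rpow_add_rpow _ _ hs)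
    have h4 : ENNReal.ofReal (g t) = ‖f t‖ₑ ^ s * ENNReal.ofReal ((1 - t) ^ (2 * α)) := by
      rw [hg, ENNReal.ofReal_mul (by positivity), ← ENNReal.ofReal_rpow_of_nonneg (norm_nonneg _)
        hs0.le, ofReal_norm]
    have h5 : I ^ s * ENNReal.ofReal ((1 - t) ^ (2 * α)) ≤
        D₂ * ENNReal.ofReal (2 ^ (3 * α / 2)) * Q := by
      calc _ ≤ D₂ * ENNReal.ofReal ((1 - t) ^ (-(α / 2))) *
            (∫⁻ u in Set.Ioo 0 (Real.sqrt t), ‖f u‖ₑ ^ s * ENNReal.ofReal ((1 - u) ^ (α / 2 - 1)))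
              * ENNReal.ofReal ((1 - t) ^ (2 * α)) :=
            mul_le_mul_left (hhol _ t hfc.measurable.enorm ht0 ht.2) _
        _ = D₂ * (ENNReal.ofReal ((1 - t) ^ (3 * α / 2)) *
            ∫⁻ u in Set.Ioo 0 (Real.sqrt t), ‖f u‖ₑ ^ s *
              ENNReal.ofReal ((1 - u) ^ (α / 2 - 1))) := by
            have : (1 - t) ^ (3 * α / 2) = (1 - t) ^ (-(α / 2)) * (1 - t) ^ (2 * α) := by
              rw [← Real.rpow_add hV0]; congr 1; ring
            rw [this, ENNReal.ofReal_mul (by positivity)]; ring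
        _ ≤ D₂ * (ENNReal.ofReal (2 ^ (3 * α / 2)) * Q) := by
            refine mul_le_mul_right ?_ _
            rw [hQ, ← lintegral_const_mul' _ _ ENNReal.ofReal_ne_top,
              ← lintegral_const_mul' _ _ ENNReal.ofReal_ne_top]
            refine (setLIntegral_mono' measurableSet_Ioo fun u hu => ?_).trans
              (lintegral_mono_set (Set.Ioo_subset_Ioo_right hst.le))
            have hu1 : 0 < 1 - u := by linarith [hu.2]
            have h6 := rpow_mul_le_muntzKernel hα hV0 (W := 1 - T) (by linarith [ht.1]) hu1
              (by linarith [hu.2])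
            rw [mul_left_comm, mul_assoc (‖f u‖ₑ ^ s), mul_left_comm (ENNReal.ofReal (2 ^ _)),
              ← ENNReal.ofReal_mul (by positivity), mul_left_comm (ENNReal.ofReal (2 ^ _)),
              ← ENNReal.ofReal_mul (by positivity), ← ENNReal.ofReal_mul (by positivity)]
            refine mul_le_mul_right (ENNReal.ofReal_le_ofReal ?_) _
            calc (1 - t) ^ (3 * α / 2) * (1 - u) ^ (α / 2 - 1)
                = (1 - u) ^ (α - 1) * ((1 - t) ^ (3 * α / 2) * (1 - u) ^ (-(α / 2))) := by
                  rw [show α / 2 - 1 = (α - 1) + -(α / 2) by ring, Real.rpow_add hu1]; ring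
              _ ≤ _ := mul_le_mul_of_nonneg_left h6 (by positivity)
        _ = _ := by ring
    rw [h4]
    refine (mul_le_mul_left h3 _).trans ?_
    rw [mul_assoc, add_mul, mul_add]
    refine add_le_add (le_of_eq ?_) ?_
    · have e2 : (2 : ℝ≥0∞) ^ (s - 1) = ENNReal.ofReal (2 ^ (s - 1)) := by
        rw [← ENNReal.ofReal_rpow_of_pos (by norm_num)]; simp
      rw [e2, ENNReal.ofReal_rpow_of_nonneg (by positivity) hs0.le,
        Real.mul_rpow hη0.le hB0, hBs, ← ENNReal.ofReal_mul (by positivity),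
        ← ENNReal.ofReal_mul (by positivity)]
      congr 1
      have e3 : (1 - t) ^ (-(2 * α)) * (1 - t) ^ (2 * α) = 1 := by
        rw [← Real.rpow_add hV0]; simp
      calc _ = (2 ^ (s - 1) * (η ^ s * 2 ^ (2 * α))) * m *
            ((1 - t) ^ (-(2 * α)) * (1 - t) ^ (2 * α)) := by ring
        _ = _ := by rw [hηs, e3]; ring
    · rw [ENNReal.mul_rpow_of_nonneg _ _ hs0.le, hD₃]
      calc _ = 2 ^ (s - 1) * (ENNReal.ofReal D₁ ^ s *
            (I ^ s * ENNReal.ofReal ((1 - t) ^ (2 * α)))) := by ring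
        _ ≤ 2 ^ (s - 1) * (ENNReal.ofReal D₁ ^ s *
            (D₂ * ENNReal.ofReal (2 ^ (3 * α / 2)) * Q)) :=
            mul_le_mul_right (mul_le_mul_right h5 _) _
        _ = _ := by ring
  have hDQ : D₃ * Q ≠ ⊤ := ENNReal.mul_ne_top hD₃t hQt
  have hmle : m ≤ m / 2 + (D₃ * Q).toReal := by
    refine csSup_le ⟨_, T, hTm, rfl⟩ ?_
    rintro _ ⟨t, ht, rfl⟩
    have := hstep t ht
    rw [← ENNReal.ofReal_toReal hDQ, ← ENNReal.ofReal_add (by positivity) ENNReal.toReal_nonneg,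
      ENNReal.ofReal_le_ofReal_iff (by positivity)] at this
    exact this
  have hfin : g T ≤ 2 * (D₃ * Q).toReal := by linarith [hgm T hTm]
  calc _ = ENNReal.ofReal (g T) := by
        rw [hg, ENNReal.ofReal_mul (by positivity), ← ENNReal.ofReal_rpow_of_nonneg
          (norm_nonneg _) hs0.le, ofReal_norm]
    _ ≤ ENNReal.ofReal (2 * (D₃ * Q).toReal) := ENNReal.ofReal_le_ofReal hfin
    _ = 2 * (D₃ * Q) := by
        rw [ENNReal.ofReal_mul (by norm_num), ENNReal.ofReal_toReal hDQ]; simp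
    _ ≤ _ := by rw [add_mul, ← mul_assoc]; exact le_add_right le_rfl

/-! ### Growth of μ at 1, the kernel test and the Carleson inequality -/

theorem lintegral_weightMeasure (α : ℝ) {g : ℝ → ℝ≥0∞} (hg : Measurable g) :
    ∫⁻ x, g x ∂(weightMeasure α) =
      ∫⁻ u in Set.Ioo (0 : ℝ) 1, g u * ENNReal.ofReal ((1 - u) ^ (α - 1)) := by
  rw [weightMeasure, lintegral_withDensity_eq_lintegral_mul _ (measurable_ofReal_one_sub_rpow _) hg,
    restrict_Ioo_eq_restrict_Icc]
  exact lintegral_congr fun u => mul_comm _ _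

theorem InClassM.exists_measure_le {γ : ℝ} {μ : Measure ℝ} (hμ : InClassM γ μ) (hγ : 0 < γ) :
    ∃ C : ℝ≥0, ∀ ε : ℝ, 0 < ε →
      μ.restrict (Set.Ioo 0 1) {T | 1 - T ≤ ε} ≤ C * ENNReal.ofReal (ε ^ γ) := by
  obtain ⟨C, hC⟩ := hμ
  refine ⟨C, fun ε hε => ?_⟩
  rw [Measure.restrict_apply' measurableSet_Ioo]
  rcases le_total ε 1 with h1 | h1
  · refine (measure_mono fun T hT => ?_).trans (hC ε hε h1)
    have := hT.1
    simp only [Set.mem_ofPred_eq] at this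
    exact ⟨by linarith, hT.2.2.le⟩
  · refine (measure_mono fun T hT => ?_).trans ((hC 1 one_pos le_rfl).trans
      (mul_le_mul_right (ENNReal.ofReal_le_ofReal ?_) _))
    · exact ⟨by linarith [hT.2.1], hT.2.2.le⟩
    · exact Real.rpow_le_rpow zero_le_one h1 hγ.le

/-- The pointwise bound is available only for T < 1, so the endpoint must be null. -/
theorem InClassM.measure_singleton_one {γ : ℝ} {μ : Measure ℝ} (hμ : InClassM γ μ) (hγ : 0 < γ) :
    μ {1} = 0 := by
  obtain ⟨C, hC⟩ := hμ
  have h1 : Tendsto (fun ε : ℝ => (C : ℝ≥0∞) * ENNReal.ofReal (ε ^ γ)) (nhdsWithin 0 (Set.Ioi 0))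
      (nhds 0) := by
    have h2 : Tendsto (fun ε : ℝ => ε ^ γ) (nhdsWithin 0 (Set.Ioi 0)) (nhds 0) := by
      have := (Real.continuous_rpow_const hγ.le).tendsto (0 : ℝ)
      rw [Real.zero_rpow hγ.ne'] at this
      exact this.mono_left nhdsWithin_le_nhds
    have h3 := ENNReal.Tendsto.const_mul (a := (C : ℝ≥0∞)) (ENNReal.tendsto_ofReal h2)
      (Or.inr ENNReal.coe_ne_top)
    simpa using h3
  refine le_antisymm (ge_of_tendsto h1 ?_) (zero_le)
  filter_upwards [Ioc_mem_nhdsGT (show (0 : ℝ) < 1 by norm_num)] with ε hε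
  refine (measure_mono fun T hT => ?_).trans (hC ε hε.1 hε.2)
  rw [Set.mem_singleton_iff.1 hT]
  exact ⟨by linarith [hε.1], le_rfl⟩

theorem tsum_ofReal_geometric_ne_top {r : ℝ} (h0 : 0 ≤ r) (h1 : r < 1) :
    ∑' i : ℕ, ENNReal.ofReal (r ^ i) ≠ ⊤ := by
  rw [← ENNReal.ofReal_tsum_of_nonneg (fun i => by positivity)
    (summable_geometric_of_lt_one h0 h1)]
  exact ENNReal.ofReal_ne_top

/-- Schur-type test: the kernel is uniformly integrable in its first variable. -/
theorem InClassM.exists_lintegral_kernel_le {γ : ℝ} {μ : Measure ℝ} (hμ : InClassM γ μ)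
    (hγ : 0 < γ) : ∃ D : ℝ≥0∞, D ≠ ⊤ ∧ ∀ v : ℝ, 0 < v →
      ∫⁻ T in Set.Ioo (0 : ℝ) 1, ENNReal.ofReal (min ((1 - T) ^ (-(γ / 2)) * v ^ (-(γ / 2)))
        ((1 - T) ^ (-(2 * γ)) * v ^ γ)) ∂μ ≤ D := by
  obtain ⟨C, hC⟩ := hμ.exists_measure_le hγ
  set r₁ : ℝ := 2 ^ (-(γ / 2)) with hr₁
  set r₂ : ℝ := 2 ^ (-γ) with hr₂
  have hr₁1 : r₁ < 1 := Real.rpow_lt_one_of_one_lt_of_neg (by norm_num) (by linarith)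
  have hr₂1 : r₂ < 1 := Real.rpow_lt_one_of_one_lt_of_neg (by norm_num) (by linarith)
  have hr₁0 : 0 < r₁ := by positivity
  have hr₂0 : 0 < r₂ := by positivity
  refine ⟨(C * ENNReal.ofReal r₁⁻¹) * ∑' i : ℕ, ENNReal.ofReal (r₁ ^ i) +
    (C * ENNReal.ofReal r₂⁻¹) * ∑' i : ℕ, ENNReal.ofReal (r₂ ^ i), ?_, fun v hv => ?_⟩
  · have h1 := tsum_ofReal_geometric_ne_top hr₁0.le hr₁1
    have h2 := tsum_ofReal_geometric_ne_top hr₂0.le hr₂1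
    finiteness
  -- Dyadic shells in V = 1-T. On V ≈ 2^(-i) v the first entry of the minimum times the measure is
  -- O(2^(-iγ/2)); on V ≈ 2^i v the second gives O(2^(-iγ)). The powers of v cancel.
  set c₁ : ℕ → ℝ := fun i => r₁⁻¹ * (r₁⁻¹) ^ i * v ^ (-γ) with hc₁
  set c₂ : ℕ → ℝ := fun i => (r₂ ^ 2) ^ i * v ^ (-γ) with hc₂
  set A₁ : ℕ → Set ℝ := fun i => {T | 1 - T ≤ (1 / 2) ^ i * v} with hA₁
  set A₂ : ℕ → Set ℝ := fun i => {T | 1 - T ≤ 2 ^ (i + 1) * v} with hA₂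
  have hA₁m : ∀ i, MeasurableSet (A₁ i) := fun i =>
    measurableSet_le (measurable_const.sub measurable_id) measurable_const
  have hA₂m : ∀ i, MeasurableSet (A₂ i) := fun i =>
    measurableSet_le (measurable_const.sub measurable_id) measurable_const
  have hpow : ∀ (x : ℝ) (i : ℕ), ((2 : ℝ) ^ i) ^ x = ((2 : ℝ) ^ x) ^ i := fun x i => by
    rw [← Real.rpow_natCast, ← Real.rpow_natCast, ← Real.rpow_mul (by norm_num),
      ← Real.rpow_mul (by norm_num), mul_comm]
  have hpt : ∀ T ∈ Set.Ioo (0 : ℝ) 1,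
      ENNReal.ofReal (min ((1 - T) ^ (-(γ / 2)) * v ^ (-(γ / 2)))
        ((1 - T) ^ (-(2 * γ)) * v ^ γ)) ≤
      ∑' i, (A₁ i).indicator (fun _ => ENNReal.ofReal (c₁ i)) T +
      ∑' i, (A₂ i).indicator (fun _ => ENNReal.ofReal (c₂ i)) T := by
    intro T hT
    have hV : 0 < 1 - T := by linarith [hT.2]
    have hx : 0 < (1 - T) / v := by positivity
    rcases le_total ((1 - T) / v) 1 with h1 | h1
    · obtain ⟨i, hi1, hi2⟩ := exists_nat_pow_near_of_lt_one hx h1 (y := 1 / 2) (by norm_num)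
        (by norm_num)
      rw [lt_div_iff₀ hv] at hi1
      rw [div_le_iff₀ hv] at hi2
      refine le_trans ?_ (le_add_right (ENNReal.le_tsum i))
      rw [Set.indicator_of_mem (show T ∈ A₁ i from hi2)]
      refine ENNReal.ofReal_le_ofReal ((min_le_left _ _).trans ?_)
      calc (1 - T) ^ (-(γ / 2)) * v ^ (-(γ / 2))
          ≤ ((1 / 2) ^ (i + 1) * v) ^ (-(γ / 2)) * v ^ (-(γ / 2)) := by
            refine mul_le_mul_of_nonneg_right ?_ (by positivity)
            exact Real.rpow_le_rpow_of_nonpos (by positivity) hi1.le (by linarith)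
        _ = _ := by
            rw [Real.mul_rpow (by positivity) hv.le, mul_assoc, ← Real.rpow_add hv, hc₁,
              one_div, inv_pow, Real.inv_rpow (by positivity), hpow, ← hr₁]
            beta_reduce
            rw [← inv_pow, pow_succ', show -(γ / 2) + -(γ / 2) = -γ by ring]
    · obtain ⟨i, hi1, hi2⟩ := exists_nat_pow_near h1 (y := (2 : ℝ)) (by norm_num)
      rw [le_div_iff₀ hv] at hi1
      rw [div_lt_iff₀ hv] at hi2
      refine le_trans ?_ (le_add_left (ENNReal.le_tsum i))
      rw [Set.indicator_of_mem (show T ∈ A₂ i from hi2.le)]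
      refine ENNReal.ofReal_le_ofReal ((min_le_right _ _).trans ?_)
      calc (1 - T) ^ (-(2 * γ)) * v ^ γ
          ≤ (2 ^ i * v) ^ (-(2 * γ)) * v ^ γ := by
            refine mul_le_mul_of_nonneg_right ?_ (by positivity)
            exact Real.rpow_le_rpow_of_nonpos (by positivity) hi1 (by linarith)
        _ = _ := by
            rw [Real.mul_rpow (by positivity) hv.le, mul_assoc, ← Real.rpow_add hv, hc₂, hpow]
            beta_reduce
            congr 1
            · congr 1
              rw [hr₂, ← Real.rpow_natCast, ← Real.rpow_mul (by norm_num)]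
              congr 1; push_cast; ring
            · congr 1; ring
  refine (setLIntegral_mono' measurableSet_Ioo hpt).trans ?_
  have hm₁ : ∀ i, Measurable ((A₁ i).indicator fun _ => ENNReal.ofReal (c₁ i)) := fun i =>
    measurable_const.indicator (hA₁m i)
  have hm₂ : ∀ i, Measurable ((A₂ i).indicator fun _ => ENNReal.ofReal (c₂ i)) := fun i =>
    measurable_const.indicator (hA₂m i)
  rw [lintegral_add_left (Measurable.tsum hm₁), lintegral_tsum fun i => (hm₁ i).aemeasurable,
    lintegral_tsum fun i => (hm₂ i).aemeasurable, ← ENNReal.tsum_mul_left, ← ENNReal.tsum_mul_left]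
  have hvγ : v ^ (-γ) * v ^ γ = 1 := by rw [← Real.rpow_add hv]; simp
  refine add_le_add (ENNReal.tsum_le_tsum fun i => ?_) (ENNReal.tsum_le_tsum fun i => ?_)
  · rw [lintegral_indicator_const (hA₁m i)]
    refine (mul_le_mul_right (hC _ (by positivity)) _).trans (le_of_eq ?_)
    rw [mul_left_comm, mul_assoc, ← ENNReal.ofReal_mul (by positivity),
      ← ENNReal.ofReal_mul (by positivity)]
    congr 2
    have e : ((1 / 2 : ℝ) ^ i * v) ^ γ = (r₁ ^ i) ^ 2 * v ^ γ := by
      rw [Real.mul_rpow (by positivity) hv.le, one_div, inv_pow, Real.inv_rpow (by positivity),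
        hpow, ← inv_pow, ← Real.rpow_neg (by norm_num), ← pow_mul, mul_comm i 2, pow_mul, hr₁,
        ← Real.rpow_natCast (2 ^ (-(γ / 2))) 2, ← Real.rpow_mul (by norm_num)]
      congr 3; push_cast; ring
    have e2 : (r₁⁻¹) ^ i * r₁ ^ i = 1 := by rw [← mul_pow, inv_mul_cancel₀ hr₁0.ne', one_pow]
    rw [e]
    calc _ = r₁⁻¹ * ((r₁⁻¹) ^ i * r₁ ^ i) * r₁ ^ i * (v ^ (-γ) * v ^ γ) := by ring
      _ = _ := by rw [hvγ, e2]; ring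
  · rw [lintegral_indicator_const (hA₂m i)]
    refine (mul_le_mul_right (hC _ (by positivity)) _).trans (le_of_eq ?_)
    rw [mul_left_comm, mul_assoc, ← ENNReal.ofReal_mul (by positivity),
      ← ENNReal.ofReal_mul (by positivity)]
    congr 2
    have e : ((2 : ℝ) ^ (i + 1) * v) ^ γ = r₂⁻¹ ^ (i + 1) * v ^ γ := by
      rw [Real.mul_rpow (by positivity) hv.le, hpow, hr₂, Real.rpow_neg (by norm_num), inv_inv]
    have e2 : (r₂⁻¹) ^ i * r₂ ^ i = 1 := by rw [← mul_pow, inv_mul_cancel₀ hr₂0.ne', one_pow]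
    rw [e]
    calc _ = r₂⁻¹ * ((r₂⁻¹) ^ i * r₂ ^ i) * r₂ ^ i * (v ^ (-γ) * v ^ γ) := by ring
      _ = _ := by rw [hvγ, e2]; ring

theorem muntzSum_zero {lam : ℕ → ℝ} (hpos : ∀ i, 0 < lam i) (a : ℕ → ℂ) (K : ℕ) :
    muntzSum lam a K 0 = 0 :=
  Finset.sum_eq_zero fun j _ => by rw [Real.zero_rpow (hpos j).ne']; simp

theorem InClassM.lintegral_muntzSum_eq {lam : ℕ → ℝ} (hpos : ∀ i, 0 < lam i) {γ : ℝ}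
    {μ : Measure ℝ} (hμ : InClassM γ μ) (hγ : 0 < γ) (hμ01 : μ (Set.Icc (0 : ℝ) 1)ᶜ = 0)
    (a : ℕ → ℂ) (K : ℕ) {p : ℝ} (hp : 0 < p) :
    ∫⁻ x, ‖muntzSum lam a K x‖ₑ ^ p ∂μ =
      ∫⁻ x in Set.Ioo (0 : ℝ) 1, ‖muntzSum lam a K x‖ₑ ^ p ∂μ := by
  rw [← lintegral_indicator measurableSet_Ioo]
  refine lintegral_congr_ae ?_
  filter_upwards [mem_ae_iff.2 hμ01, compl_mem_ae_iff.2 (hμ.measure_singleton_one hγ)] with x hx hx1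
  rcases hx.1.eq_or_lt with rfl | h0
  · rw [muntzSum_zero hpos]; simp [hp]
  · rw [Set.indicator_of_mem]
    exact ⟨h0, lt_of_le_of_ne hx.2 hx1⟩

/-- The Carleson embedding inequality. -/
theorem IsLacunaryMajorant.exists_lintegral_muntzSum_le {lam σ : ℕ → ℝ} {θ C : ℝ}
    (h : IsLacunaryMajorant lam σ θ C) {α β s : ℝ} (hα : 0 < α) (hβ : 1 ≤ β) (hs : 1 ≤ s)
    {μ : Measure ℝ} [IsFiniteMeasure μ] (hμ : InClassM (α * β) μ)
    (hμ01 : μ (Set.Icc (0 : ℝ) 1)ᶜ = 0) :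
    ∃ D : ℝ≥0∞, D ≠ ⊤ ∧ ∀ (a : ℕ → ℂ) (K : ℕ),
      ∫⁻ x, ‖muntzSum lam a K x‖ₑ ^ (s * β) ∂μ ≤
        D * (∫⁻ x, ‖muntzSum lam a K x‖ₑ ^ s ∂(weightMeasure α)) ^ β := by
  have hβ0 : 0 < β := by linarith
  have hs0 : 0 < s := by linarith
  have hγ : 0 < α * β := by positivity
  obtain ⟨D₁, hD₁, hpt⟩ := h.exists_enorm_muntzSum_rpow_le hα hs
  obtain ⟨D₂, hD₂, hker⟩ := hμ.exists_lintegral_kernel_le hγ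
  refine ⟨D₁ ^ β * D₂, ENNReal.mul_ne_top (ENNReal.rpow_ne_top_of_nonneg hβ0.le hD₁) hD₂,
    fun a K => ?_⟩
  set f := muntzSum lam a K with hf
  have hfc : Continuous f := continuous_muntzSum h.pos a K
  set w : ℝ → ℝ≥0∞ := fun u => ‖f u‖ₑ ^ s * ENNReal.ofReal ((1 - u) ^ (α - 1)) with hw
  have hwm : Measurable w := (hfc.measurable.enorm.pow_const s).mul
    (measurable_ofReal_one_sub_rpow _)
  set k : ℝ → ℝ → ℝ≥0∞ := fun T u => ENNReal.ofReal (muntzKernel α (1 - T) (1 - u)) with hk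
  have hkm : Measurable (Function.uncurry k) := measurable_muntzKernel α
  rw [lintegral_weightMeasure α (hfc.measurable.enorm.pow_const s)]
  set W := ∫⁻ u in Set.Ioo (0 : ℝ) 1, w u with hW
  rw [hμ.lintegral_muntzSum_eq h.pos hγ hμ01 a K (by positivity)]
  -- Hölder against w(u) du yields W^(β-1); the remaining factor W appears after integrating in T
  -- first.
  have hbound : ∀ T ∈ Set.Ioo (0 : ℝ) 1, ‖f T‖ₑ ^ (s * β) ≤ D₁ ^ β * W ^ (β - 1) *
      ∫⁻ u in Set.Ioo (0 : ℝ) 1, w u *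
        (ENNReal.ofReal ((1 - T) ^ (-(2 * α * β))) * k T u ^ β) := by
    intro T hT
    have hV : 0 < 1 - T := by linarith [hT.2]
    have h1 := ENNReal.rpow_le_rpow (hpt a K T hT.1 hT.2) hβ0.le
    rw [ENNReal.mul_rpow_of_nonneg _ _ hβ0.le, ENNReal.mul_rpow_of_nonneg _ _ hβ0.le,
      ← ENNReal.rpow_mul, ENNReal.ofReal_rpow_of_nonneg (by positivity) hβ0.le,
      ← Real.rpow_mul hV.le] at h1
    have h2 := lintegral_mul_rpow_le (ν := volume.restrict (Set.Ioo (0 : ℝ) 1)) hwm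
      (hkm.of_uncurry_left (x := T)) hβ
    have h3 : ENNReal.ofReal ((1 - T) ^ (2 * α * β)) * ENNReal.ofReal ((1 - T) ^ (-(2 * α * β)))
        = 1 := by
      rw [← ENNReal.ofReal_mul (by positivity), ← Real.rpow_add hV]; simp
    calc ‖f T‖ₑ ^ (s * β) = ‖f T‖ₑ ^ (s * β) * ENNReal.ofReal ((1 - T) ^ (2 * α * β)) *
          ENNReal.ofReal ((1 - T) ^ (-(2 * α * β))) := by rw [mul_assoc, h3, mul_one]
      _ ≤ D₁ ^ β * (W ^ (β - 1) * ∫⁻ u in Set.Ioo (0 : ℝ) 1, w u * k T u ^ β) *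
          ENNReal.ofReal ((1 - T) ^ (-(2 * α * β))) :=
          mul_le_mul_left (h1.trans (mul_le_mul_right h2 _)) _
      _ = D₁ ^ β * W ^ (β - 1) * (ENNReal.ofReal ((1 - T) ^ (-(2 * α * β))) *
          ∫⁻ u in Set.Ioo (0 : ℝ) 1, w u * k T u ^ β) := by ring
      _ = _ := by
          rw [← lintegral_const_mul' _ _ ENNReal.ofReal_ne_top]
          congr 1
          exact lintegral_congr fun u => by ring
  refine (setLIntegral_mono' measurableSet_Ioo hbound).trans ?_
  have hmeas : Measurable (Function.uncurry fun T u : ℝ => w u *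
      (ENNReal.ofReal ((1 - T) ^ (-(2 * α * β))) * k T u ^ β)) :=
    (hwm.comp measurable_snd).mul (((measurable_ofReal_one_sub_rpow _).comp measurable_fst).mul
      (hkm.pow_const β))
  rw [lintegral_const_mul _ hmeas.lintegral_prod_right, lintegral_lintegral_swap hmeas.aemeasurable]
  have hin : ∫⁻ u in Set.Ioo (0 : ℝ) 1, ∫⁻ T in Set.Ioo (0 : ℝ) 1, w u *
      (ENNReal.ofReal ((1 - T) ^ (-(2 * α * β))) * k T u ^ β) ∂μ ≤ W * D₂ := by
    rw [hW, ← lintegral_mul_const _ hwm]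
    refine setLIntegral_mono' measurableSet_Ioo fun u hu => ?_
    have hv : 0 < 1 - u := by linarith [hu.2]
    have hmT : Measurable fun T => ENNReal.ofReal ((1 - T) ^ (-(2 * α * β))) * k T u ^ β :=
      (measurable_ofReal_one_sub_rpow _).mul ((hkm.of_uncurry_right (y := u)).pow_const β)
    rw [lintegral_const_mul _ hmT]
    refine mul_le_mul_right (le_trans (le_of_eq ?_) (hker (1 - u) hv)) _
    refine setLIntegral_congr_fun measurableSet_Ioo fun T hT => ?_
    have hV : 0 < 1 - T := by linarith [hT.2]
    have hmin : ∀ x y : ℝ, 0 ≤ x → 0 ≤ y → (min x y) ^ β = min (x ^ β) (y ^ β) := by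
      intro x y hx hy
      rcases le_total x y with hxy | hxy
      · rw [min_eq_left hxy, min_eq_left (Real.rpow_le_rpow hx hxy hβ0.le)]
      · rw [min_eq_right hxy, min_eq_right (Real.rpow_le_rpow hy hxy hβ0.le)]
    simp only [hk]
    rw [ENNReal.ofReal_rpow_of_nonneg (by unfold muntzKernel; positivity) hβ0.le,
      ← ENNReal.ofReal_mul (by positivity), muntzKernel, hmin _ _ (by positivity) (by positivity),
      mul_min_of_nonneg _ _ (by positivity), Real.mul_rpow (by positivity) (by positivity),
      ← Real.rpow_mul hV.le, ← Real.rpow_mul hv.le, ← Real.rpow_mul hv.le, ← mul_assoc,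
      ← Real.rpow_add hV]
    refine congrArg ENNReal.ofReal (congrArg₂ min (congrArg₂ (· * ·) ?_ ?_)
      (congrArg₂ (· * ·) ?_ ?_)) <;> congr 1 <;> ring
  refine (mul_le_mul_right hin _).trans (le_of_eq ?_)
  have hWW : W ^ (β - 1) * W = W ^ β := by
    conv_lhs => rw [← ENNReal.rpow_one W, ← ENNReal.rpow_mul, one_mul]
    rw [← ENNReal.rpow_add_of_nonneg _ _ (by linarith) zero_le_one, sub_add_cancel]
  calc _ = D₁ ^ β * D₂ * (W ^ (β - 1) * W) := by ring
    _ = _ := by rw [hWW]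

/-! ### Weighted norms and extension by density -/

theorem exists_muntzSum_of_mem {lam : ℕ → ℝ} {f : ℝ → ℂ} (hf : f ∈ muntzPolynomials lam) :
    ∃ (a : ℕ → ℂ) (K : ℕ), f = muntzSum lam a K := by
  obtain ⟨c, rfl⟩ := Finsupp.mem_span_range_iff_exists_finsupp.1 hf
  refine ⟨c, c.support.sup id + 1, ?_⟩
  ext t
  rw [Finsupp.sum, Finset.sum_apply, muntzSum]
  refine Finset.sum_subset (fun j hj => ?_) fun j _ hj => ?_
  · exact Finset.mem_range.2 (Nat.lt_succ_of_le (Finset.le_sup (f := id) hj))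
  · simp [Finsupp.notMem_support_iff.1 hj]

theorem lintegral_exp_mul_one_sub_rpow_le {α r : ℝ} (hα : 0 < α) (hr : 0 < r) :
    ∫⁻ u in Set.Ioo (0 : ℝ) 1, ENNReal.ofReal ((1 - u) ^ (α - 1) * Real.exp (-(r * (1 - u)))) ≤
      ENNReal.ofReal ((1 / r) ^ α * Real.Gamma α) := by
  have key := Real.integral_rpow_mul_exp_neg_mul_Ioi hα hr
  have hint : IntegrableOn (fun x : ℝ => x ^ (α - 1) * Real.exp (-(r * x))) (Set.Ioi 0) :=
    .of_integral_ne_zero (by rw [key]; have := Real.Gamma_pos_of_pos hα; positivity)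
  set G : ℝ → ℝ≥0∞ := (Set.Ioi (0 : ℝ)).indicator
    fun x => ENNReal.ofReal (x ^ (α - 1) * Real.exp (-(r * x))) with hG
  calc _ ≤ ∫⁻ u, G (1 - u) := by
        rw [← lintegral_indicator measurableSet_Ioo]
        refine lintegral_mono (Set.indicator_le (g := fun u => G (1 - u)) fun u hu => ?_)
        rw [hG, Set.indicator_of_mem (show 1 - u ∈ Set.Ioi (0 : ℝ) from sub_pos.2 hu.2)]
    _ = ∫⁻ u, G u := lintegral_sub_left_eq_self G 1
    _ = _ := by
        rw [hG, lintegral_indicator measurableSet_Ioi, ← key, ofReal_integral_eq_lintegral_ofReal hint]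
        refine (ae_restrict_iff' measurableSet_Ioi).2 (Eventually.of_forall fun u hu => ?_)
        exact mul_nonneg (Real.rpow_nonneg (le_of_lt hu) _) (Real.exp_pos _).le

theorem isFiniteMeasure_weightMeasure {α : ℝ} (hα : 0 < α) :
    IsFiniteMeasure (weightMeasure α) := by
  refine ⟨?_⟩
  have h1 := lintegral_weightMeasure α (g := fun _ => 1) measurable_const
  rw [lintegral_one] at h1
  rw [h1]
  refine lt_of_le_of_lt ?_ (ENNReal.mul_lt_top (ENNReal.ofReal_lt_top (r := Real.exp 1))
    (ENNReal.ofReal_lt_top (r := (1 / 1) ^ α * Real.Gamma α)))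
  refine le_trans ?_ (mul_le_mul_right (lintegral_exp_mul_one_sub_rpow_le hα one_pos) _)
  rw [← lintegral_const_mul' _ _ ENNReal.ofReal_ne_top]
  refine setLIntegral_mono' measurableSet_Ioo fun u hu => ?_
  have hp : 0 ≤ (1 - u) ^ (α - 1) := Real.rpow_nonneg (by linarith [hu.2]) _
  rw [one_mul, ← ENNReal.ofReal_mul (Real.exp_pos _).le]
  refine ENNReal.ofReal_le_ofReal ?_
  rw [mul_left_comm, ← Real.exp_add]
  exact le_mul_of_one_le_right hp (Real.one_le_exp (by linarith [hu.1]))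

theorem weightMeasure_compl_Icc (α : ℝ) : weightMeasure α (Set.Icc (0 : ℝ) 1)ᶜ = 0 := by
  refine withDensity_absolutelyContinuous _ _ ?_
  rw [Measure.restrict_apply measurableSet_Icc.compl]
  simp

theorem lintegral_rpow_weightMeasure_le {α l : ℝ} (hα : 0 < α) (hl : 0 < l) :
    ∫⁻ x, ENNReal.ofReal (x ^ l) ∂(weightMeasure α) ≤
      ENNReal.ofReal ((1 / l) ^ α * Real.Gamma α) := by
  rw [lintegral_weightMeasure α (by fun_prop)]
  refine (setLIntegral_mono' measurableSet_Ioo fun u hu => ?_).trans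
    (lintegral_exp_mul_one_sub_rpow_le hα hl)
  have hp : 0 ≤ (1 - u) ^ (α - 1) := Real.rpow_nonneg (by linarith [hu.2]) _
  rw [← ENNReal.ofReal_mul (Real.rpow_nonneg hu.1.le _), mul_comm]
  refine ENNReal.ofReal_le_ofReal (mul_le_mul_of_nonneg_left ?_ hp)
  rw [Real.rpow_def_of_pos hu.1]
  refine Real.exp_le_exp.2 ?_
  nlinarith [Real.log_le_sub_one_of_pos hu.1]

theorem memLp_of_mem_muntzPolynomials {lam : ℕ → ℝ} (hpos : ∀ i, 0 < lam i) {f : ℝ → ℂ}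
    (hf : f ∈ muntzPolynomials lam) (s : ℝ≥0∞) {μ : Measure ℝ} [IsFiniteMeasure μ]
    (hμ : μ (Set.Icc (0 : ℝ) 1)ᶜ = 0) : MemLp f s μ := by
  obtain ⟨a, K, rfl⟩ := exists_muntzSum_of_mem hf
  refine MemLp.of_bound (continuous_muntzSum hpos a K).aestronglyMeasurable
    (∑ j ∈ Finset.range K, ‖a j‖) ?_
  filter_upwards [mem_ae_iff.2 hμ] with x hx
  exact norm_muntzSum_le hpos a K hx.1 hx.2

/-- A bounded embedding exists if the norm inequality holds for Müntz polynomials. -/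
theorem muntzEmbedding_of_eLpNorm_le {lam : ℕ → ℝ} (hpos : ∀ i, 0 < lam i) {α s r : ℝ}
    (hα : 0 < α) {μ : Measure ℝ} [IsFiniteMeasure μ] (hμ : μ (Set.Icc (0 : ℝ) 1)ᶜ = 0)
    (hs : 1 ≤ s) (hr : 1 ≤ r) {D : ℝ≥0∞} (hD : D ≠ ⊤)
    (hle : ∀ f ∈ muntzPolynomials lam, eLpNorm f (ENNReal.ofReal r) μ ≤
      D * eLpNorm f (ENNReal.ofReal s) (weightMeasure α)) :
    MuntzEmbedding lam α s r μ hs hr := by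
  have : Fact (1 ≤ ENNReal.ofReal s) := ⟨ENNReal.one_le_ofReal.2 hs⟩
  have : Fact (1 ≤ ENNReal.ofReal r) := ⟨ENNReal.one_le_ofReal.2 hr⟩
  have := isFiniteMeasure_weightMeasure hα
  have hw : ∀ {f}, f ∈ muntzPolynomials lam → MemLp f (ENNReal.ofReal s) (weightMeasure α) :=
    fun hf => memLp_of_mem_muntzPolynomials hpos hf _ (weightMeasure_compl_Icc α)
  have hm : ∀ {f}, f ∈ muntzPolynomials lam → MemLp f (ENNReal.ofReal r) μ :=
    fun hf => memLp_of_mem_muntzPolynomials hpos hf _ hμ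
  have hr0 : ENNReal.ofReal r ≠ 0 := by simp; linarith
  -- The norm inequality for f - g makes the μ-class independent of the chosen polynomial
  -- representative, so the map on classes is well defined and linear.
  have hcongr : ∀ {f g}, f ∈ muntzPolynomials lam → g ∈ muntzPolynomials lam →
      f =ᵐ[weightMeasure α] g → f =ᵐ[μ] g := by
    intro f g hf hg hfg
    have h1 := hle _ (sub_mem hf hg)
    have h2 : eLpNorm (f - g) (ENNReal.ofReal s) (weightMeasure α) = 0 := by
      rw [eLpNorm_congr_ae (g := 0) (by filter_upwards [hfg] with x hx; simp [hx]), eLpNorm_zero]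
    rw [h2, mul_zero, nonpos_iff_eq_zero,
      eLpNorm_eq_zero_iff (hm (sub_mem hf hg)).aestronglyMeasurable hr0] at h1
    filter_upwards [h1] with x hx
    exact sub_eq_zero.1 hx
  let rep : muntzClasses lam α (ENNReal.ofReal s) → ℝ → ℂ := fun F => F.2.choose
  have hrep : ∀ F, rep F ∈ muntzPolynomials lam := fun F => F.2.choose_spec.1
  have hrepF : ∀ F : muntzClasses lam α (ENNReal.ofReal s), (F : Lp ℂ (ENNReal.ofReal s) (weightMeasure α)) =ᵐ[weightMeasure α] rep F :=
    fun F => F.2.choose_spec.2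
  have hto : ∀ (F : muntzClasses lam α (ENNReal.ofReal s)) {f}, f ∈ muntzPolynomials lam →
      (F : Lp ℂ (ENNReal.ofReal s) (weightMeasure α)) =ᵐ[weightMeasure α] f →
      (hm (hrep F)).toLp (rep F) =ᵐ[μ] f := fun F f hf hFf =>
    (MemLp.coeFn_toLp _).trans (hcongr (hrep F) hf ((hrepF F).symm.trans hFf))
  let φ : muntzClasses lam α (ENNReal.ofReal s) →ₗ[ℂ] Lp ℂ (ENNReal.ofReal r) μ :=
    { toFun := fun F => (hm (hrep F)).toLp (rep F)
      map_add' := fun F G => by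
        refine Lp.ext ?_
        refine (hto (F + G) (add_mem (hrep F) (hrep G)) ?_).trans ?_
        · exact (Lp.coeFn_add _ _).trans ((hrepF F).add (hrepF G))
        · exact (((MemLp.coeFn_toLp _).add (MemLp.coeFn_toLp _)).symm).trans
            (Lp.coeFn_add _ _).symm
      map_smul' := fun c F => by
        refine Lp.ext ?_
        refine (hto (c • F) (Submodule.smul_mem _ c (hrep F)) ?_).trans ?_
        · exact (Lp.coeFn_smul _ _).trans ((hrepF F).const_smul c)
        · exact (((MemLp.coeFn_toLp _).const_smul c).symm).trans (Lp.coeFn_smul _ _).symm }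
  let e : muntzClasses lam α (ENNReal.ofReal s) →ₗ[ℂ] muntzSpace lam α (ENNReal.ofReal s) :=
    Submodule.inclusion (Submodule.le_topologicalClosure _)
  have hdense : DenseRange e :=
    (denseRange_inclusion_iff (Submodule.le_topologicalClosure _)).2 (le_of_eq rfl)
  have hnorm : ∀ F, ‖φ F‖ ≤ D.toReal * ‖e F‖ := by
    intro F
    have h1 : ‖e F‖ = (eLpNorm (rep F) (ENNReal.ofReal s) (weightMeasure α)).toReal := by
      rw [← eLpNorm_congr_ae (hrepF F)]; rfl
    have h2 : ‖φ F‖ = (eLpNorm (rep F) (ENNReal.ofReal r) μ).toReal := Lp.norm_toLp _ (hm (hrep F))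
    rw [h1, h2, ← ENNReal.toReal_mul]
    exact ENNReal.toReal_mono (ENNReal.mul_ne_top hD (hw (hrep F)).eLpNorm_ne_top)
      (hle _ (hrep F))
  refine ⟨φ.extendOfNorm e, fun f hf => ?_⟩
  let F : muntzClasses lam α (ENNReal.ofReal s) :=
    ⟨(hw hf).toLp f, f, hf, MemLp.coeFn_toLp (hw hf)⟩
  refine ⟨e F, MemLp.coeFn_toLp (hw hf), ?_⟩
  rw [LinearMap.extendOfNorm_eq hdense ⟨_, hnorm⟩]
  exact hto F hf (MemLp.coeFn_toLp (hw hf))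

theorem MuntzEmbedding.exists_eLpNorm_le {lam : ℕ → ℝ} {α s r : ℝ} {μ : Measure ℝ}
    {hs : 1 ≤ s} {hr : 1 ≤ r} (h : MuntzEmbedding lam α s r μ hs hr) :
    ∃ D : ℝ≥0∞, D ≠ ⊤ ∧ ∀ f ∈ muntzPolynomials lam, eLpNorm f (ENNReal.ofReal r) μ ≤
      D * eLpNorm f (ENNReal.ofReal s) (weightMeasure α) := by
  have : Fact (1 ≤ ENNReal.ofReal s) := ⟨ENNReal.one_le_ofReal.2 hs⟩
  have : Fact (1 ≤ ENNReal.ofReal r) := ⟨ENNReal.one_le_ofReal.2 hr⟩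
  obtain ⟨J, hJ⟩ := h
  refine ⟨‖J‖ₑ, enorm_ne_top, fun f hf => ?_⟩
  obtain ⟨F, hF, hJF⟩ := hJ f hf
  rw [← eLpNorm_congr_ae hF, ← eLpNorm_congr_ae hJF, ← Lp.enorm_def, ← Lp.enorm_def]
  exact J.le_opENorm F

/-! ### Necessity: testing on monomials -/

theorem exp_neg_two_le_rpow {l t : ℝ} (hl : 2 ≤ l) (ht : 1 - 1 / l ≤ t) :
    Real.exp (-2) ≤ t ^ l := by
  have hl0 : 0 < l := by linarith
  have h1 : (l - 1) / l ≤ t := by rwa [sub_div, div_self hl0.ne']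
  have ht0 : 0 < t := lt_of_lt_of_le (div_pos (by linarith) hl0) h1
  have h2 := Real.one_sub_inv_le_log_of_pos ht0
  have h3 : t⁻¹ ≤ l / (l - 1) := by
    rw [← inv_div]; exact inv_anti₀ (div_pos (by linarith) hl0) h1
  have h4 : l / (l - 1) ≤ 1 + 2 / l := by
    rw [div_le_iff₀ (by linarith)]
    have : (1 + 2 / l) * (l - 1) = l + (1 - 2 / l) := by field_simp; ring
    rw [this]
    have : 2 / l ≤ 1 := by rw [div_le_one hl0]; exact hl
    linarith
  rw [Real.rpow_def_of_pos ht0]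
  refine Real.exp_le_exp.2 ?_
  have h5 : -(2 / l) ≤ Real.log t := by linarith
  have h6 : -(2 / l) * l = -2 := by field_simp
  nlinarith

/-- The monomial t^lam_k is at least exp(-2) on the interval, while its weighted L^1 norm is at most
Γ(α) lam_k^(-α). -/
theorem measure_Icc_le_of_eLpNorm_le {lam : ℕ → ℝ} (hpos : ∀ i, 0 < lam i) {α β : ℝ}
    (hα : 0 < α) (hβ : 1 ≤ β) {μ : Measure ℝ} {D : ℝ≥0∞}
    (hle : ∀ f ∈ muntzPolynomials lam, eLpNorm f (ENNReal.ofReal β) μ ≤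
      D * eLpNorm f 1 (weightMeasure α)) (k : ℕ) (hk : 2 ≤ lam k) :
    μ (Set.Icc (1 - 1 / lam k) 1) ≤
      (ENNReal.ofReal (Real.exp 2) * D * ENNReal.ofReal (Real.Gamma α)) ^ β *
        ENNReal.ofReal ((1 / lam k) ^ (α * β)) := by
  have hβ0 : 0 < β := by linarith
  have hl := hpos k
  set f : ℝ → ℂ := fun t => ((t ^ lam k : ℝ) : ℂ) with hf
  have hfm : f ∈ muntzPolynomials lam := Submodule.subset_span ⟨k, rfl⟩
  have h1 := hle f hfm
  have hG := Real.Gamma_pos_of_pos hα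
  have h2 : eLpNorm f 1 (weightMeasure α) ≤
      ENNReal.ofReal ((1 / lam k) ^ α * Real.Gamma α) := by
    rw [eLpNorm_one_eq_lintegral_enorm]
    refine le_trans (le_of_eq (lintegral_congr_ae ?_)) (lintegral_rpow_weightMeasure_le hα hl)
    filter_upwards [mem_ae_iff.2 (weightMeasure_compl_Icc α)] with x hx
    rw [← ofReal_norm, Complex.norm_real, Real.norm_of_nonneg (Real.rpow_nonneg hx.1 _)]
  have h3 : ENNReal.ofReal (Real.exp (-2)) * μ (Set.Icc (1 - 1 / lam k) 1) ^ (1 / β) ≤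
      eLpNorm f (ENNReal.ofReal β) μ := by
    rw [eLpNorm_eq_lintegral_rpow_enorm_toReal (by simpa using hβ0) ENNReal.ofReal_ne_top,
      ENNReal.toReal_ofReal hβ0.le]
    have e : ENNReal.ofReal (Real.exp (-2)) * μ (Set.Icc (1 - 1 / lam k) 1) ^ (1 / β) =
        (ENNReal.ofReal (Real.exp (-2)) ^ β * μ (Set.Icc (1 - 1 / lam k) 1)) ^ (1 / β) := by
      rw [ENNReal.mul_rpow_of_nonneg _ _ (by positivity), ← ENNReal.rpow_mul,
        mul_one_div_cancel hβ0.ne', ENNReal.rpow_one]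
    rw [e]
    refine ENNReal.rpow_le_rpow ?_ (by positivity)
    rw [← setLIntegral_const]
    refine (setLIntegral_mono' measurableSet_Icc fun t ht => ?_).trans (setLIntegral_le_lintegral _ _)
    refine ENNReal.rpow_le_rpow ?_ hβ0.le
    rw [← ofReal_norm, Complex.norm_real]
    exact ENNReal.ofReal_le_ofReal ((exp_neg_two_le_rpow hk ht.1).trans (le_abs_self _))
  have h4 := h3.trans (h1.trans (mul_le_mul_right h2 _))
  have h5 : μ (Set.Icc (1 - 1 / lam k) 1) ^ (1 / β) ≤
      (ENNReal.ofReal (Real.exp 2) * D * ENNReal.ofReal (Real.Gamma α)) *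
        ENNReal.ofReal ((1 / lam k) ^ α) := by
    have e : ENNReal.ofReal (Real.exp 2) * ENNReal.ofReal (Real.exp (-2)) = 1 := by
      rw [← ENNReal.ofReal_mul (Real.exp_pos _).le, ← Real.exp_add]; simp
    calc _ = ENNReal.ofReal (Real.exp 2) * (ENNReal.ofReal (Real.exp (-2)) *
          μ (Set.Icc (1 - 1 / lam k) 1) ^ (1 / β)) := by rw [← mul_assoc, e, one_mul]
      _ ≤ _ := mul_le_mul_right h4 _
      _ = _ := by rw [ENNReal.ofReal_mul (by positivity)]; ring
  have h6 := ENNReal.rpow_le_rpow h5 hβ0.le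
  rwa [← ENNReal.rpow_mul, one_div_mul_cancel hβ0.ne', ENNReal.rpow_one,
    ENNReal.mul_rpow_of_nonneg _ _ hβ0.le, ENNReal.ofReal_rpow_of_nonneg (by positivity) hβ0.le,
    ← Real.rpow_mul (by positivity)] at h6

/-- For a subgeometric sequence it suffices to test the growth of `μ` along the sequence. -/
theorem inClassM_of_measure_Icc_le {lam : ℕ → ℝ} (hpos : ∀ k, 0 < lam k) (hmono : StrictMono lam)
    (h : IsQuasiLacunarySubgeometric lam) {γ : ℝ} (hγ : 0 < γ) {μ : Measure ℝ} [IsFiniteMeasure μ]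
    {D : ℝ≥0∞} (hD : D ≠ ⊤) (hle : ∀ k, 2 ≤ lam k →
      μ (Set.Icc (1 - 1 / lam k) 1) ≤ D * ENNReal.ofReal ((1 / lam k) ^ γ)) :
    InClassM γ μ := by
  obtain ⟨σ, θ, C, hmaj⟩ := h.exists_majorant hpos hmono
  obtain ⟨N, n, ⟨hn, -, -⟩, -, q, hq, hqe⟩ := h
  have htend : Tendsto (fun k => lam (n k)) atTop atTop :=
    hmaj.tendsto_atTop.comp hn.tendsto_atTop
  obtain ⟨k₀, hk₀⟩ := eventually_atTop.1 (hqe.and (htend.eventually_ge_atTop 2))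
  set L := lam (n k₀) with hL
  have hL0 : 0 < L := hpos _
  have hfin : D * ENNReal.ofReal (q ^ γ) + μ Set.univ * ENNReal.ofReal (L ^ γ) ≠ ⊤ := by
    finiteness
  -- The second term covers ε > 1/L through the total mass. For smaller ε, 1/ε lies between
  -- consecutive block ends, whose ratio is at most q.
  refine ⟨(D * ENNReal.ofReal (q ^ γ) + μ Set.univ * ENNReal.ofReal (L ^ γ)).toNNReal,
    fun ε hε hε1 => ?_⟩
  rw [ENNReal.coe_toNNReal hfin, add_mul, mul_assoc, mul_assoc,
    ← ENNReal.ofReal_mul (by positivity), ← ENNReal.ofReal_mul (by positivity),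
    ← Real.mul_rpow (by linarith) hε.le, ← Real.mul_rpow hL0.le hε.le]
  rcases lt_or_ge (1 / ε) L with hc | hc
  · refine le_trans (measure_mono (Set.subset_univ _)) (le_add_left ?_)
    refine le_mul_of_one_le_right (zero_le) ?_
    rw [ENNReal.one_le_ofReal]
    rw [div_lt_iff₀ hε] at hc
    exact Real.one_le_rpow hc.le hγ.le
  · obtain ⟨k, hkk, hk1, hk2⟩ : ∃ k, k₀ ≤ k ∧ lam (n k) ≤ 1 / ε ∧ 1 / ε < lam (n (k + 1)) := by
      classical
      have hex : ∃ d, 1 / ε < lam (n (k₀ + d)) := by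
        obtain ⟨k, hk, hk'⟩ := ((htend.eventually_gt_atTop (1 / ε)).and
          (eventually_ge_atTop k₀)).exists
        exact ⟨k - k₀, by rwa [Nat.add_sub_cancel' hk']⟩
      have hs := Nat.find_spec hex
      have hd : Nat.find hex ≠ 0 := by
        intro h0
        rw [h0] at hs
        exact absurd hc (not_le.2 hs)
      obtain ⟨d, hd'⟩ := Nat.exists_eq_succ_of_ne_zero hd
      refine ⟨k₀ + d, by omega, not_lt.1 (Nat.find_min hex (by omega)), ?_⟩
      rw [hd'] at hs
      exact hs
    have hl := hpos (n k)
    obtain ⟨hr, h2⟩ := hk₀ k hkk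
    rw [div_le_iff₀ hl] at hr
    refine le_trans ?_ (le_add_right le_rfl)
    refine (measure_mono (Set.Icc_subset_Icc_left ?_)).trans ((hle (n k) h2).trans
      (mul_le_mul_right (ENNReal.ofReal_le_ofReal ?_) _))
    · have : ε ≤ 1 / lam (n k) := by rwa [le_one_div hε hl]
      linarith
    · refine Real.rpow_le_rpow (by positivity) ?_ hγ.le
      rw [div_le_iff₀ hl]
      have := hk2.trans_le hr
      rw [div_lt_iff₀ hε] at this
      linarith

/-! ### The equivalence -/

theorem IsLacunaryMajorant.exists_eLpNorm_le {lam σ : ℕ → ℝ} {θ C : ℝ}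
    (h : IsLacunaryMajorant lam σ θ C) {α β p : ℝ} (hα : 0 < α) (hβ : 1 ≤ β) (hp : β ≤ p)
    {μ : Measure ℝ} [IsFiniteMeasure μ] (hμ : InClassM (α * β) μ)
    (hμ01 : μ (Set.Icc (0 : ℝ) 1)ᶜ = 0) :
    ∃ D : ℝ≥0∞, D ≠ ⊤ ∧ ∀ f ∈ muntzPolynomials lam, eLpNorm f (ENNReal.ofReal p) μ ≤
      D * eLpNorm f (ENNReal.ofReal (p / β)) (weightMeasure α) := by
  have hβ0 : 0 < β := by linarith
  have hp0 : 0 < p := by linarith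
  have hs : 1 ≤ p / β := (one_le_div hβ0).2 hp
  have hs0 : 0 < p / β := by linarith
  obtain ⟨D, hD, hle⟩ := h.exists_lintegral_muntzSum_le hα hβ hs hμ hμ01
  refine ⟨D ^ (1 / p), ENNReal.rpow_ne_top_of_nonneg (by positivity) hD, fun f hf => ?_⟩
  obtain ⟨a, K, rfl⟩ := exists_muntzSum_of_mem hf
  rw [eLpNorm_eq_lintegral_rpow_enorm_toReal (by simpa using hp0) ENNReal.ofReal_ne_top,
    eLpNorm_eq_lintegral_rpow_enorm_toReal (by simpa using hs0) ENNReal.ofReal_ne_top,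
    ENNReal.toReal_ofReal hp0.le, ENNReal.toReal_ofReal hs0.le]
  have h1 := ENNReal.rpow_le_rpow (hle a K) (show 0 ≤ 1 / p by positivity)
  rw [div_mul_cancel₀ _ hβ0.ne', ENNReal.mul_rpow_of_nonneg _ _ (by positivity),
    ← ENNReal.rpow_mul, show β * (1 / p) = 1 / (p / β) by field_simp] at h1
  exact h1

theorem mainTheorem4 (Λ : ℕ → ℝ) (hΛpos : ∀ k, 0 < Λ k) (hΛmono : StrictMono Λ)
    (hΛ : IsQuasiLacunarySubgeometric Λ) (α β : ℝ) (hα : 0 < α) (hβ : 1 ≤ β)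
    (μ : Measure ℝ) [IsFiniteMeasure μ] (hμ : μ (Set.Icc (0 : ℝ) 1)ᶜ = 0) :
    InClassM (α * β) μ ↔
      ∀ (p : ℝ) (hp : β ≤ p),
        MuntzEmbedding Λ α (p / β) p μ
          ((one_le_div (zero_lt_one.trans_le hβ)).2 hp) (hβ.trans hp) := by
  have hβ0 : 0 < β := by linarith
  constructor
  · intro hM p hp
    obtain ⟨σ, θ, C, hmaj⟩ := hΛ.exists_majorant hΛpos hΛmono
    obtain ⟨D, hD, hle⟩ := hmaj.exists_eLpNorm_le hα hβ hp hM hμ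
    exact muntzEmbedding_of_eLpNorm_le hΛpos hα hμ _ _ hD hle
  · intro hE
    obtain ⟨D, hD, hle⟩ := (hE β le_rfl).exists_eLpNorm_le
    rw [div_self hβ0.ne', ENNReal.ofReal_one] at hle
    refine inClassM_of_measure_Icc_le hΛpos hΛmono hΛ (by positivity) ?_
      fun k hk => measure_Icc_le_of_eLpNorm_le hΛpos hα hβ hle k hk
    exact ENNReal.rpow_ne_top_of_nonneg hβ0.le (by finiteness)
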